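/- Let $\mathcal N$ be a smooth manifold with metric hypersurface data $\{\mathcal N,\gamma,\ell,\ell^{(2)}\}$: $\gamma$ is a smooth symmetric two-covariant tensor field, $\ell$ a smooth one-form and $\ell^{(2)}$ a smooth function, such that at every $p$ the symmetric bilinear form $$\mathcal A((W,a),(Z,b))=\gamma(W,Z)+a\,\ell(Z)+b\,\ell(W)+ab\,\ell^{(2)}$$ on $T_p\mathcal N\times\mathbb R$ is non-degenerate. Let $\mathcal A^\sharp$ be its inverse, and define the function $n^{(2)}$ and the vector field $n$ by $n^{(2)}=\mathcal A^\sharp((0,1),(0,1))$ and $\beta(n)=\mathcal A^\sharp((\beta,0),(0,1))$ for all covectors $\beta$. Set $$U=\tfrac12\pounds_n\gamma+\tfrac12\left(\ell\otimes dn^{(2)}+dn^{(2)}\otimes\ell\right),\qquad F=\tfrac12\,d\ell,\qquad \hat s=i_nF=F(n,\cdot).$$ A metric hypersurface connection is a smooth torsion-free connection $\mathring\nabla$ on $T\mathcal N$ such that, for all smooth vector fields $X,Z,W$, $$(\mathring\nabla_X\gamma)(Z,W)=-U(X,Z)\ell(W)-U(X,W)\ell(Z),\qquad (\mathring\nabla_X\ell)(Z)+(\mathring\nabla_Z\ell)(X)=-2\,\ell^{(2)}\,U(X,Z).$$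 Such a connection exists. For every such connection, let $R(X,Y)Z=\mathring\nabla_X\mathring\nabla_YZ-\mathring\nabla_Y\mathring\nabla_XZ-\mathring\nabla_{[X,Y]}Z$, and let $\mathring{Ric}(X,Y)=\operatorname{tr}(W\mapsto R(W,Y)X)$ and $\mathring V(X,Y)=\operatorname{tr}(Z\mapsto R(X,Y)Z)$ be the traces of the curvature tensor $\alpha(R(X,Y)Z)$, with slots ordered as $(\alpha,Z,X,Y)$, over its first and third and over its first and second slots, respectively. Then for all smooth vector fields $X,Y$ $$\mathring{Ric}(X,Y)-\mathring{Ric}(Y,X)=\mathring V(X,Y)=\left(d\hat s-\tfrac12\,dn^{(2)}\wedge d\ell^{(2)}\right)(X,Y),$$ where $d\theta(X,Y)=X(\theta(Y))-Y(\theta(X))-\theta([X,Y])$ for a one-form $\theta$ and $(df\wedge dg)(X,Y)=X(f)Y(g)-Y(f)X(g)$. -/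

import Mathlib

open scoped Manifold ContDiff

noncomputable section

namespace HypersurfaceData

/-- Smooth vector fields on a smooth (boundaryless) manifold `M` modelled on the
finite-dimensional real vector space `E`. -/
abbrev VectorFields (E M : Type*) [NormedAddCommGroup E] [NormedSpace ℝ E]
    [TopologicalSpace M] [ChartedSpace E M] [IsManifold 𝓘(ℝ, E) ∞ M] : Type _ :=
  ContMDiffSection 𝓘(ℝ, E) E ∞ (fun p : M => TangentSpace 𝓘(ℝ, E) p)

/-- Connections (covariant derivatives) on the tangent bundle of `M`. -/
abbrev Connection (E M : Type*) [NormedAddCommGroup E] [NormedSpace ℝ E]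
    [TopologicalSpace M] [ChartedSpace E M] [IsManifold 𝓘(ℝ, E) ∞ M] : Type _ :=
  CovariantDerivative 𝓘(ℝ, E) E (fun p : M => TangentSpace 𝓘(ℝ, E) p)

section

variable {E : Type*} [NormedAddCommGroup E] [NormedSpace ℝ E] [FiniteDimensional ℝ E]
  {M : Type*} [TopologicalSpace M] [ChartedSpace E M] [IsManifold 𝓘(ℝ, E) ∞ M]

instance tangentSpace_finiteDimensional (p : M) :
    FiniteDimensional ℝ (TangentSpace 𝓘(ℝ, E) p) :=
  inferInstanceAs (FiniteDimensional ℝ E)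

/-! ### Smooth vector fields -/

/-- The Lie bracket of two smooth vector fields. -/
def bracket (X Y : VectorFields E M) : VectorFields E M where
  toFun := VectorField.mlieBracket 𝓘(ℝ, E) X Y
  contMDiff_toFun := by
    have : CompleteSpace E := FiniteDimensional.complete ℝ E
    have : IsManifold 𝓘(ℝ, E) (((⊤ : ℕ∞) : ℕ∞ω) + 1) M := ‹IsManifold 𝓘(ℝ, E) ∞ M›
    have : IsManifold 𝓘(ℝ, E) (minSmoothness ℝ 2) M := by
      rw [minSmoothness_of_isRCLikeNormedField]; infer_instance
    exact ContDiff.mlieBracket_vectorField (m := ⊤) (n := ⊤) X.contMDiff Y.contMDiff (by simp)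

theorem bracket_add_left (X X' Y : VectorFields E M) :
    bracket (X + X') Y = bracket X Y + bracket X' Y := by
  have : CompleteSpace E := FiniteDimensional.complete ℝ E
  ext p
  exact VectorField.mlieBracket_add_left X.mdifferentiableAt X'.mdifferentiableAt

theorem bracket_smul_left (a : ℝ) (X Y : VectorFields E M) :
    bracket (a • X) Y = a • bracket X Y := by
  have : CompleteSpace E := FiniteDimensional.complete ℝ E
  ext p
  exact VectorField.mlieBracket_const_smul_left X.mdifferentiableAt

/-- Evaluation of smooth vector fields at a point. -/
def evalAt (p : M) : VectorFields E M →ₗ[ℝ] TangentSpace 𝓘(ℝ, E) p where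
  toFun X := X p
  map_add' _ _ := rfl
  map_smul' _ _ := rfl

/-- Every tangent vector is the value of a global smooth vector field. -/
theorem evalAt_surjective [T2Space M] (p : M) :
    Function.Surjective (evalAt (E := E) p) := by
  intro v
  obtain ⟨s, hs, hsmooth⟩ := FiberBundle.exists_contMDiffOn_extend (k := ∞) 𝓘(ℝ, E) E v
  obtain ⟨u, hus, hu, hpu⟩ := mem_nhds_iff.mp hs
  obtain ⟨f, -, hf⟩ := (SmoothBumpFunction.nhds_basis_tsupport (I := 𝓘(ℝ, E)) p).mem_iff.mp
    (hu.mem_nhds hpu)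
  refine ⟨⟨(f : M → ℝ) • FiberBundle.extend E v,
    ContMDiffOn.smul_section_of_tsupport f.contMDiff.contMDiffOn hu hf (hsmooth.mono hus)⟩, ?_⟩
  change f p • FiberBundle.extend E v p = v
  simp

/-- A linear choice of global smooth vector fields with prescribed value at `p`. -/
def extendFrom [T2Space M] (p : M) : TangentSpace 𝓘(ℝ, E) p →ₗ[ℝ] VectorFields E M :=
  ((evalAt (E := E) p).exists_rightInverse_of_surjective
    (LinearMap.range_eq_top.mpr (evalAt_surjective p))).choose

/-- The defining property of the choice of extensions. -/
theorem extendFrom_apply_self [T2Space M] (p : M) (v : TangentSpace 𝓘(ℝ, E) p) :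
    extendFrom p v p = v :=
  congrArg (fun L => L v) ((evalAt (E := E) p).exists_rightInverse_of_surjective
    (LinearMap.range_eq_top.mpr (evalAt_surjective p))).choose_spec

/-- The trace at `p` of an operator `Φ` on vector fields: the trace of the endomorphism
`v ↦ Φ(Z)|_p` of `T_pM`, where `Z` is a smooth vector field with `Z|_p = v`. If `Φ` is linear over
the smooth functions (the only case in which it is used below), then `Φ` is a tensor field of type
`(1,1)`, the endomorphism does not depend on `Z`, and this is the trace of that tensor at `p`. -/
def traceAt [T2Space M] (p : M) (Φ : VectorFields E M →ₗ[ℝ] VectorFields E M) : ℝ :=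
  LinearMap.trace ℝ (TangentSpace 𝓘(ℝ, E) p) (evalAt (E := E) p ∘ₗ Φ ∘ₗ extendFrom p)

/-! ### Curvature of a smooth connection -/

section Curvature

set_option linter.unusedSectionVars false

variable (cov : Connection E M) [hc : cov.ContMDiffCovariantDerivative ∞]

/-- `∇_X Z` for a smooth connection `∇` and smooth vector fields `X`, `Z`. -/
def nabla (X Z : VectorFields E M) : VectorFields E M where
  toFun p := cov Z p (X p)
  contMDiff_toFun := by
    have h := (hc.contMDiff.contMDiff (σ := Z) Z.contMDiff.contMDiffOn)
    rw [contMDiffOn_univ] at h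
    exact ContMDiff.clm_bundle_apply h X.contMDiff

theorem nabla_add_right (X Z Z' : VectorFields E M) :
    nabla cov X (Z + Z') = nabla cov X Z + nabla cov X Z' := by
  ext p
  have := cov.isCovariantDerivativeOnUniv.add (x := p) Z.mdifferentiableAt Z'.mdifferentiableAt
  exact congrArg (fun L => L (X p)) this

theorem nabla_smul_right (a : ℝ) (X Z : VectorFields E M) :
    nabla cov X (a • Z) = a • nabla cov X Z := by
  ext p
  have := cov.isCovariantDerivativeOnUniv.smul_const (x := p) a Z.mdifferentiableAt
  exact congrArg (fun L => L (X p)) this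

theorem nabla_add_left (X X' Z : VectorFields E M) :
    nabla cov (X + X') Z = nabla cov X Z + nabla cov X' Z := by
  ext p
  exact map_add (cov Z p) (X p) (X' p)

theorem nabla_smul_left (a : ℝ) (X Z : VectorFields E M) :
    nabla cov (a • X) Z = a • nabla cov X Z := by
  ext p
  exact map_smul (cov Z p) a (X p)

/-- The curvature operator `R(X,Y)Z = ∇_X ∇_Y Z - ∇_Y ∇_X Z - ∇_{[X,Y]} Z`. The curvature tensor
is `Riem(α,Z,X,Y) = α(R(X,Y)Z)`. -/
def curvature (X Y Z : VectorFields E M) : VectorFields E M :=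
  nabla cov X (nabla cov Y Z) - nabla cov Y (nabla cov X Z) - nabla cov (bracket X Y) Z

/-- The Ricci tensor, the trace of `Riem(α,X,W,Y)` over its first and third arguments:
`Ric(X,Y) = trace (W ↦ R(W,Y)X)`. -/
def ricci [T2Space M] (X Y : VectorFields E M) (p : M) : ℝ :=
  traceAt p
    { toFun := fun W => curvature cov W Y X
      map_add' := fun W W' => by
        simp only [curvature, nabla_add_right, nabla_add_left, bracket_add_left]
        abel
      map_smul' := fun a W => by
        simp only [curvature, nabla_smul_right, nabla_smul_left, bracket_smul_left,
          RingHom.id_apply, smul_sub] }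

/-- The trace `V` of `Riem(α,Z,X,Y)` over its first and second arguments:
`V(X,Y) = trace (Z ↦ R(X,Y)Z)`. -/
def riemannTrace [T2Space M] (X Y : VectorFields E M) (p : M) : ℝ :=
  traceAt p
    { toFun := fun Z => curvature cov X Y Z
      map_add' := fun Z Z' => by
        simp only [curvature, nabla_add_right]
        abel
      map_smul' := fun a Z => by
        simp only [curvature, nabla_smul_right, RingHom.id_apply, smul_sub] }

end Curvature

/-! ### Derivatives of functions and one-forms

One-forms `θ` enter through their action `X ↦ θ(X)` on vector fields. -/

/-- The derivative `X(f)` of a function along a vector field; this is also `df(X)`. -/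
def along (X : Π p : M, TangentSpace 𝓘(ℝ, E) p) (f : M → ℝ) (p : M) : ℝ :=
  mvfderiv 𝓘(ℝ, E) f p (X p)

/-- The exterior derivative of a one-form:
`dθ(X,Y) = X(θ(Y)) - Y(θ(X)) - θ([X,Y])`. -/
def dOneForm (θ : (Π p : M, TangentSpace 𝓘(ℝ, E) p) → M → ℝ)
    (X Y : Π p : M, TangentSpace 𝓘(ℝ, E) p) (p : M) : ℝ :=
  along X (θ Y) p - along Y (θ X) p - θ (VectorField.mlieBracket 𝓘(ℝ, E) X Y) p

/-- The value `(df ∧ dg)(X,Y) = X(f) Y(g) - Y(f) X(g)`. -/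
def wedgeDiff (f g : M → ℝ) (X Y : Π p : M, TangentSpace 𝓘(ℝ, E) p) (p : M) : ℝ :=
  along X f p * along Y g p - along Y f p * along X g p

end

/-! ### Metric hypersurface data -/

/-- The symmetric bilinear form
`A((W,a),(Z,b)) = γ(W,Z) + a ℓ(Z) + b ℓ(W) + a b ℓ₂` on `V × ℝ`. -/
def extendedForm {V : Type*} [AddCommGroup V] [Module ℝ V] [TopologicalSpace V]
    (γ : V →L[ℝ] V →L[ℝ] ℝ) (ℓ : V →L[ℝ] ℝ) (ℓ₂ : ℝ) : LinearMap.BilinForm ℝ (V × ℝ) :=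
  LinearMap.mk₂ ℝ (fun w z => γ w.1 z.1 + w.2 * ℓ z.1 + z.2 * ℓ w.1 + w.2 * z.2 * ℓ₂)
    (fun w w' z => by simp; ring) (fun a w z => by simp; ring)
    (fun w z z' => by simp; ring) (fun a w z => by simp; ring)

/-- Metric hypersurface data `{M, γ, ℓ, ℓ⁽²⁾}` (all fields smooth). -/
structure MetricData (E M : Type*) [NormedAddCommGroup E] [NormedSpace ℝ E]
    [TopologicalSpace M] [ChartedSpace E M] [IsManifold 𝓘(ℝ, E) ∞ M] where
  /-- the symmetric two-covariant tensor field `γ` -/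
  γ : Π p : M, TangentSpace 𝓘(ℝ, E) p →L[ℝ] TangentSpace 𝓘(ℝ, E) p →L[ℝ] ℝ
  /-- the one-form `ℓ` -/
  ℓ : Π p : M, TangentSpace 𝓘(ℝ, E) p →L[ℝ] ℝ
  /-- the scalar field `ℓ⁽²⁾` -/
  ℓ₂ : M → ℝ
  smooth_γ : ContMDiff 𝓘(ℝ, E) (𝓘(ℝ, E).prod 𝓘(ℝ, E →L[ℝ] E →L[ℝ] ℝ)) ∞
    (fun p => Bundle.TotalSpace.mk' (E →L[ℝ] E →L[ℝ] ℝ)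
      (E := fun p : M => TangentSpace 𝓘(ℝ, E) p →L[ℝ] TangentSpace 𝓘(ℝ, E) p →L[ℝ] ℝ) p (γ p))
  smooth_ℓ : ContMDiff 𝓘(ℝ, E) (𝓘(ℝ, E).prod 𝓘(ℝ, E →L[ℝ] ℝ)) ∞
    (fun p => Bundle.TotalSpace.mk' (E →L[ℝ] ℝ)
      (E := fun p : M => TangentSpace 𝓘(ℝ, E) p →L[ℝ] ℝ) p (ℓ p))
  smooth_ℓ₂ : ContMDiff 𝓘(ℝ, E) 𝓘(ℝ, ℝ) ∞ ℓ₂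
  symm : ∀ p v w, γ p v w = γ p w v
  nondegenerate : ∀ p, (extendedForm (γ p) (ℓ p) (ℓ₂ p)).Nondegenerate

namespace MetricData

variable {E : Type*} [NormedAddCommGroup E] [NormedSpace ℝ E] [FiniteDimensional ℝ E]
  {M : Type*} [TopologicalSpace M] [ChartedSpace E M] [IsManifold 𝓘(ℝ, E) ∞ M]
  (D : MetricData E M)

/-- The tensor `A` at `p`, on `T_pM × ℝ`. -/
def A (p : M) : LinearMap.BilinForm ℝ (TangentSpace 𝓘(ℝ, E) p × ℝ) :=
  extendedForm (D.γ p) (D.ℓ p) (D.ℓ₂ p)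

theorem A_nondegenerate (p : M) : (D.A p).Nondegenerate := D.nondegenerate p

/-- The inverse tensor `A♯` at `p`, a bilinear form on the dual of `T_pM × ℝ`. -/
def ASharp (p : M) : LinearMap.BilinForm ℝ (Module.Dual ℝ (TangentSpace 𝓘(ℝ, E) p × ℝ)) :=
  LinearMap.mk₂ ℝ (fun α β => α (((D.A p).toDual (D.A_nondegenerate p)).symm β))
    (fun _ _ _ => rfl) (fun _ _ _ => rfl) (fun _ _ _ => by simp) (fun _ _ _ => by simp)

/-- The defining property `A♯(·, A(V,·)) = V`. -/
theorem ASharp_apply (p : M) (α : Module.Dual ℝ (TangentSpace 𝓘(ℝ, E) p × ℝ))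
    (v : TangentSpace 𝓘(ℝ, E) p × ℝ) : D.ASharp p α (D.A p v) = α v := by
  change α (((D.A p).toDual (D.A_nondegenerate p)).symm
    ((D.A p).toDual (D.A_nondegenerate p) v)) = α v
  rw [LinearEquiv.symm_apply_apply]

/-- The scalar `n⁽²⁾ = A♯((0,1),(0,1))`; the covector `(0,1)` is the second projection. -/
def n₂ (p : M) : ℝ :=
  D.ASharp p (LinearMap.snd ℝ _ ℝ) (LinearMap.snd ℝ _ ℝ)

/-- The vector field `n`, given by `β(n) = A♯((β,0),(0,1))` for all covectors `β`. -/
def n (p : M) : TangentSpace 𝓘(ℝ, E) p :=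
  (Module.evalEquiv ℝ (TangentSpace 𝓘(ℝ, E) p)).symm
    ((D.ASharp p).flip (LinearMap.snd ℝ _ ℝ) ∘ₗ (LinearMap.fst ℝ _ ℝ).dualMap)

theorem apply_n (p : M) (β : Module.Dual ℝ (TangentSpace 𝓘(ℝ, E) p)) :
    β (D.n p) = D.ASharp p (β ∘ₗ LinearMap.fst ℝ _ ℝ) (LinearMap.snd ℝ _ ℝ) := by
  simp [n]
  rfl

/-- `γ(X,Y)` as a function on `M`. -/
def γFun (X Y : Π p : M, TangentSpace 𝓘(ℝ, E) p) (p : M) : ℝ := D.γ p (X p) (Y p)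

/-- `ℓ(X)` as a function on `M`. -/
def ℓFun (X : Π p : M, TangentSpace 𝓘(ℝ, E) p) (p : M) : ℝ := D.ℓ p (X p)

/-- The tensor `U = ½ £_n γ + ℓ ⊗ₛ dn⁽²⁾`, where
`(£_n γ)(X,Y) = n(γ(X,Y)) - γ([n,X],Y) - γ(X,[n,Y])` and
`α ⊗ₛ β = ½ (α ⊗ β + β ⊗ α)`. -/
def U (X Y : Π p : M, TangentSpace 𝓘(ℝ, E) p) (p : M) : ℝ :=
  1 / 2 * (along D.n (D.γFun X Y) p
      - D.γFun (VectorField.mlieBracket 𝓘(ℝ, E) D.n X) Y p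
      - D.γFun X (VectorField.mlieBracket 𝓘(ℝ, E) D.n Y) p)
    + 1 / 2 * (D.ℓFun X p * along Y D.n₂ p + along X D.n₂ p * D.ℓFun Y p)

/-- The two-form `F = ½ dℓ`. -/
def F (X Y : Π p : M, TangentSpace 𝓘(ℝ, E) p) (p : M) : ℝ :=
  1 / 2 * dOneForm D.ℓFun X Y p

/-- The one-form `ŝ = i_n F`. -/
def s (X : Π p : M, TangentSpace 𝓘(ℝ, E) p) (p : M) : ℝ := D.F D.n X p

/-- `(∇_X γ)(Z,W) = X(γ(Z,W)) - γ(∇_X Z,W) - γ(Z,∇_X W)`. -/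
def nablaγ (cov : Connection E M) (X Z W : Π p : M, TangentSpace 𝓘(ℝ, E) p) (p : M) : ℝ :=
  along X (D.γFun Z W) p - D.γ p (cov Z p (X p)) (W p) - D.γ p (Z p) (cov W p (X p))

/-- `(∇_X ℓ)(Z) = X(ℓ(Z)) - ℓ(∇_X Z)`. -/
def nablaℓ (cov : Connection E M) (X Z : Π p : M, TangentSpace 𝓘(ℝ, E) p) (p : M) : ℝ :=
  along X (D.ℓFun Z) p - D.ℓ p (cov Z p (X p))

/-- The metric hypersurface connection: the torsion-free connection with
`(∇_X γ)(Z,W) = - U(X,Z) ℓ(W) - U(X,W) ℓ(Z)` and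
`(∇_X ℓ)(Z) + (∇_Z ℓ)(X) = - 2 ℓ⁽²⁾ U(X,Z)`. -/
structure IsMetricHypersurfaceConnection (cov : Connection E M) : Prop where
  torsionFree : ∀ (X Z : VectorFields E M) (p : M),
    cov Z p (X p) - cov X p (Z p) = VectorField.mlieBracket 𝓘(ℝ, E) X Z p
  nabla_γ : ∀ (X Z W : VectorFields E M) (p : M),
    D.nablaγ cov X Z W p = - D.U X Z p * D.ℓFun W p - D.U X W p * D.ℓFun Z p
  nabla_ℓ : ∀ (X Z : VectorFields E M) (p : M),
    D.nablaℓ cov X Z p + D.nablaℓ cov Z X p = - 2 * D.ℓ₂ p * D.U X Z p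

end MetricData

end HypersurfaceData

end

/-! Torsion-freeness gives the first Bianchi identity `R(W,Y)X - R(W,X)Y = R(X,Y)W`, and tracing it
over `W` gives the first equality (`ricci_sub_ricci`). For the second, `riemannTrace` is the
curvature that the connection induces on the determinant bundle: in a local frame `Z_i` it equals
`dτ`, where `τ(V)` is the trace of the connection coefficients, because the quadratic terms have
equal traces (`riemannTrace_eq`).

To find `τ`, let `G` be the Gram matrix of `A` in the frame `(Z_i,0), (0,1)`. The row of `G⁻¹`
belonging to `(0,1)` consists of `n⁽²⁾` and the components of `n`. Expanding `tr(G⁻¹ V(G))` with the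
two equations for `∇γ` and `∇ℓ`, the terms in `U` cancel and `τ(V) = ½ tr(G⁻¹ V(G)) - ½ n⁽²⁾ V(ℓ⁽²⁾)
+ ŝ(V)` (`sum_connectionCoeff`). The first term is closed (`along_alongLogDet`), so `dτ = dŝ - ½
dn⁽²⁾ ∧ dℓ⁽²⁾`.

For existence, Koszul expressions prescribe `γ(∇_X σ, W)` and `ℓ(∇_X σ)`. As `A` is non-degenerate,
they determine a vector of `T_pM × ℝ`. Its `ℝ`-component is its pairing with `(n, n⁽²⁾)`, which
vanishes because of the choice of `U` (`koszulγ_n_add`). Smoothness comes from expanding in a local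
frame with the inverse Gram matrix. -/

noncomputable section

namespace HypersurfaceData

open Bundle VectorField Filter Topology

set_option linter.unusedSectionVars false

section Calculus

variable {E : Type*} [NormedAddCommGroup E] [NormedSpace ℝ E] [FiniteDimensional ℝ E]
  {M : Type*} [TopologicalSpace M] [ChartedSpace E M] [IsManifold 𝓘(ℝ, E) ∞ M]
  {X Y Z W : Π p : M, TangentSpace 𝓘(ℝ, E) p} {f g : M → ℝ} {p : M}

/-! ### Derivatives of functions along vector fields -/

theorem along_add (hf : MDiffAt f p) (hg : MDiffAt g p) :
    along X (f + g) p = along X f p + along X g p := by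
  simp [along, mvfderiv_add hf hg]

theorem along_sub (hf : MDiffAt f p) (hg : MDiffAt g p) :
    along X (f - g) p = along X f p - along X g p := by
  simp [along, mvfderiv_sub hf hg]

theorem along_mul (hf : MDiffAt f p) (hg : MDiffAt g p) :
    along X (f * g) p = f p * along X g p + g p * along X f p := by
  simp [along, mvfderiv_mul hf hg]

theorem along_const (c : ℝ) : along X (fun _ : M => c) p = 0 := by
  simp [along, mvfderiv_const]

theorem along_const_mul (c : ℝ) (hf : MDiffAt f p) :
    along X (fun q => c * f q) p = c * along X f p := by
  have := along_mul (X := X) (p := p) (f := fun _ : M => c) mdifferentiableAt_const hf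
  rw [along_const, mul_zero, add_zero] at this
  exact this

theorem mvfderiv_congr (h : f =ᶠ[𝓝 p] g) :
    mvfderiv 𝓘(ℝ, E) f p = mvfderiv 𝓘(ℝ, E) g p := by
  ext v
  simp only [mvfderiv, ContinuousLinearMap.comp_apply]
  have := h.mfderiv_eq (I := 𝓘(ℝ, E)) (I' := 𝓘(ℝ, ℝ))
  exact congrArg (fun L : E →L[ℝ] ℝ => L v) this

theorem along_congr (h : f =ᶠ[𝓝 p] g) : along X f p = along X g p := by
  rw [along, along, mvfderiv_congr h]

theorem mdifferentiableAt_sum {ι : Type*} {s : Finset ι} {F : ι → M → ℝ}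
    (hF : ∀ i ∈ s, MDiffAt (F i) p) : MDiffAt (fun q => ∑ i ∈ s, F i q) p := by
  classical
  induction s using Finset.induction_on with
  | empty => simpa using mdifferentiableAt_const
  | insert a s ha ih =>
    have := (hF a (by simp)).add (ih fun i hi => hF i (by simp [hi]))
    refine this.congr_of_eventuallyEq (.of_forall fun q => ?_)
    simp [Finset.sum_insert ha]

theorem along_sum {ι : Type*} {s : Finset ι} {F : ι → M → ℝ} (hF : ∀ i ∈ s, MDiffAt (F i) p) :
    along X (fun q => ∑ i ∈ s, F i q) p = ∑ i ∈ s, along X (F i) p := by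
  classical
  induction s using Finset.induction_on with
  | empty => simp [along_const]
  | insert a s ha ih =>
    have h2 : ∀ i ∈ s, MDiffAt (F i) p := fun i hi => hF i (by simp [hi])
    rw [Finset.sum_insert ha, ← ih h2, ← along_add (hF a (by simp)) (mdifferentiableAt_sum h2)]
    congr 1
    ext q
    simp [Finset.sum_insert ha]

theorem along_vec_add (f : M → ℝ) : along (X + Y) f p = along X f p + along Y f p :=
  map_add _ _ _

theorem along_vec_smul (f g : M → ℝ) : along (f • X) g p = f p * along X g p :=
  map_smul _ _ _

theorem contMDiffAt_along (hX : CMDiffAt ∞ (T% X) p) (hf : CMDiffAt ∞ f p) :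
    CMDiffAt ∞ (along X f) p := by
  have h := hf.mfderiv_const (m := ∞) (by simp)
  have h2 := ContMDiffAt.clm_apply_of_inCoordinates (b₁ := id) (b₂ := f) (v := X) h hX hf
  rw [contMDiffAt_totalSpace] at h2
  refine h2.2.congr_of_eventuallyEq (.of_forall fun q => ?_)
  simp [along, mvfderiv]
  rfl

theorem _root_.ContMDiffAt.mdiffAt (hf : CMDiffAt ∞ f p) : MDiffAt f p :=
  hf.mdifferentiableAt (by simp)

theorem contMDiffAt_mlieBracket (hX : CMDiffAt ∞ (T% X) p) (hY : CMDiffAt ∞ (T% Y) p) :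
    CMDiffAt ∞ (T% (mlieBracket 𝓘(ℝ, E) X Y)) p := by
  have : CompleteSpace E := FiniteDimensional.complete ℝ E
  have : IsManifold 𝓘(ℝ, E) (((⊤ : ℕ∞) : ℕ∞ω) + 1) M := ‹IsManifold 𝓘(ℝ, E) ∞ M›
  have : IsManifold 𝓘(ℝ, E) (minSmoothness ℝ 2) M := by
    rw [minSmoothness_of_isRCLikeNormedField]; infer_instance
  exact ContMDiffAt.mlieBracket_vectorField (m := ⊤) (n := ⊤) hX hY (by simp)

/-! ### Determinants and inverses of smooth matrix functions. -/

theorem contMDiffAt_matrix_det {κ : Type*} [Fintype κ] [DecidableEq κ] {G : M → Matrix κ κ ℝ}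
    (hG : ∀ I J, CMDiffAt ∞ (fun q => G q I J) p) : CMDiffAt ∞ (fun q => (G q).det) p := by
  simp only [Matrix.det_apply']
  exact contMDiffAt_finsetSum fun σ _ =>
    contMDiffAt_const.mul (contMDiffAt_finsetProd fun i _ => hG _ _)

/-- Cramer's rule: an entry of the inverse is a quotient by `det G` of an adjugate entry, and that
is the determinant of `G` with one row replaced by a constant row. -/
theorem contMDiffAt_matrix_inv {κ : Type*} [Fintype κ] [DecidableEq κ] {G : M → Matrix κ κ ℝ}
    (hG : ∀ I J, CMDiffAt ∞ (fun q => G q I J) p) (h0 : (G p).det ≠ 0) (I J : κ) :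
    CMDiffAt ∞ (fun q => (G q)⁻¹ I J) p := by
  simp only [Matrix.inv_def, Ring.inverse_eq_inv', Matrix.smul_apply, smul_eq_mul]
  refine ((contMDiffAt_matrix_det hG).inv₀ h0).mul ?_
  simp only [Matrix.adjugate_apply]
  refine contMDiffAt_matrix_det fun K L => ?_
  by_cases h : K = J
  · subst h
    simpa using contMDiffAt_const
  · simpa [Matrix.updateRow_apply, h] using hG K L

end Calculus

namespace MetricData

variable {E : Type*} [NormedAddCommGroup E] [NormedSpace ℝ E] [FiniteDimensional ℝ E]
  {M : Type*} [TopologicalSpace M] [ChartedSpace E M] [IsManifold 𝓘(ℝ, E) ∞ M]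
  (D : MetricData E M)
  {X X' Y Y' : Π p : M, TangentSpace 𝓘(ℝ, E) p} {f : M → ℝ} {p : M}

/-! ### Algebra of the extended form -/

theorem A_apply (v w : TangentSpace 𝓘(ℝ, E) p) (a b : ℝ) :
    D.A p (v, a) (w, b) = D.γ p v w + a * D.ℓ p w + b * D.ℓ p v + a * b * D.ℓ₂ p := rfl

theorem A_symm (x y : TangentSpace 𝓘(ℝ, E) p × ℝ) : D.A p x y = D.A p y x := by
  obtain ⟨v, a⟩ := x
  obtain ⟨w, b⟩ := y
  rw [A_apply, A_apply, D.symm p v w]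
  ring

/-- Non-degeneracy of `A` applied to `(v - v', 0)`. Since `γ` alone may be degenerate, the pairing
with `ℓ` is needed too. -/
theorem ext_of_γ_of_ℓ {v v' : TangentSpace 𝓘(ℝ, E) p} (h : ∀ w, D.γ p v w = D.γ p v' w)
    (h' : D.ℓ p v = D.ℓ p v') : v = v' := by
  have h0 : ((v - v', 0) : TangentSpace 𝓘(ℝ, E) p × ℝ) = 0 := by
    refine (D.A_nondegenerate p).1 _ fun z => ?_
    obtain ⟨w, b⟩ := z
    rw [A_apply, map_sub, map_sub, sub_apply, h, h']
    ring
  exact sub_eq_zero.1 (congrArg Prod.fst h0)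

/-- `(n, n⁽²⁾)` is the vector that `A` identifies with the covector `(0,1)`. Evaluating on `(w,0)`
and on `(0,1)` yields the two contraction rules for `n`. -/
theorem A_n (z : TangentSpace 𝓘(ℝ, E) p × ℝ) : D.A p (D.n p, D.n₂ p) z = z.2 := by
  set u := ((D.A p).toDual (D.A_nondegenerate p)).symm (LinearMap.snd ℝ _ ℝ) with hu
  have h1 : D.n p = u.1 := by
    refine sub_eq_zero.1 ((Module.forall_dual_apply_eq_zero_iff ℝ (D.n p - u.1)).1 fun β => ?_)
    rw [map_sub, D.apply_n, sub_eq_zero]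
    rfl
  have h2 : D.n₂ p = u.2 := rfl
  rw [h1, h2]
  exact LinearMap.BilinForm.apply_toDual_symm_apply (hB := D.A_nondegenerate p) (LinearMap.snd ℝ _ ℝ) z

theorem γ_n (w : TangentSpace 𝓘(ℝ, E) p) : D.γ p (D.n p) w = -(D.n₂ p * D.ℓ p w) := by
  have := D.A_n (p := p) (w, 0)
  rw [A_apply] at this
  linarith

theorem ℓ_n : D.ℓ p (D.n p) = 1 - D.n₂ p * D.ℓ₂ p := by
  have := D.A_n (p := p) (0, 1)
  rw [A_apply, map_zero, map_zero] at this
  linarith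

/-! ### The functions `γ(X,Y)` and `ℓ(X)` -/

theorem γFun_comm : D.γFun X Y = D.γFun Y X := funext fun q => D.symm q _ _

theorem γFun_add_left : D.γFun (X + X') Y = D.γFun X Y + D.γFun X' Y := by
  ext q; simp [γFun]

theorem γFun_add_right : D.γFun X (Y + Y') = D.γFun X Y + D.γFun X Y' := by
  ext q; simp [γFun]

theorem γFun_smul_left : D.γFun (f • X) Y = f * D.γFun X Y := by
  ext q; simp [γFun]

theorem γFun_smul_right : D.γFun X (f • Y) = f * D.γFun X Y := by
  ext q; simp [γFun]

theorem ℓFun_add : D.ℓFun (X + X') = D.ℓFun X + D.ℓFun X' := by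
  ext q; simp [ℓFun]

theorem ℓFun_smul : D.ℓFun (f • X) = f * D.ℓFun X := by
  ext q; simp [ℓFun]

theorem γFun_n : D.γFun X D.n = -(D.n₂ * D.ℓFun X) := by
  rw [γFun_comm]
  ext q
  exact D.γ_n _

theorem contMDiffAt_γFun (hX : CMDiffAt ∞ (T% X) p) (hY : CMDiffAt ∞ (T% Y) p) :
    CMDiffAt ∞ (D.γFun X Y) p := by
  have h := ContMDiffAt.clm_bundle_apply₂ (E₃ := Bundle.Trivial M ℝ) (F₃ := ℝ) (b := id)
    D.smooth_γ.contMDiffAt hX hY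
  rw [contMDiffAt_totalSpace] at h
  exact h.2

theorem contMDiffAt_ℓFun (hX : CMDiffAt ∞ (T% X) p) : CMDiffAt ∞ (D.ℓFun X) p := by
  have h := ContMDiffAt.clm_bundle_apply (E₂ := Bundle.Trivial M ℝ) (F₂ := ℝ) (b := id)
    D.smooth_ℓ.contMDiffAt hX
  rw [contMDiffAt_totalSpace] at h
  exact h.2

theorem mdifferentiableAt_γFun (hX : MDiffAt (T% X) p) (hY : MDiffAt (T% Y) p) :
    MDiffAt (D.γFun X Y) p := by
  have h := MDifferentiableAt.clm_bundle_apply₂ (E₃ := Bundle.Trivial M ℝ) (F₃ := ℝ) (b := id)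
    (D.smooth_γ.contMDiffAt.mdifferentiableAt (by simp)) hX hY
  rw [mdifferentiableAt_totalSpace] at h
  exact h.2

theorem mdifferentiableAt_ℓFun (hX : MDiffAt (T% X) p) : MDiffAt (D.ℓFun X) p := by
  have h := MDifferentiableAt.clm_bundle_apply (E₂ := Bundle.Trivial M ℝ) (F₂ := ℝ) (b := id)
    (D.smooth_ℓ.contMDiffAt.mdifferentiableAt (by simp)) hX
  rw [mdifferentiableAt_totalSpace] at h
  exact h.2

end MetricData

namespace MetricData

variable {E : Type*} [NormedAddCommGroup E] [NormedSpace ℝ E] [FiniteDimensional ℝ E]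
  {M : Type*} [TopologicalSpace M] [ChartedSpace E M] [IsManifold 𝓘(ℝ, E) ∞ M]
  (D : MetricData E M)

/-! ### The Gram matrix of a local frame -/

section Gram

variable {ι : Type*} (Z : ι → Π p : M, TangentSpace 𝓘(ℝ, E) p) {p : M}

/-- The vectors `(Z_i, 0)` and `(0, 1)` of `T_pM × ℝ`. -/
def frameVec (q : M) (I : Option ι) : TangentSpace 𝓘(ℝ, E) q × ℝ :=
  I.elim (0, 1) fun i => (Z i q, 0)

/-- The Gram matrix of the tensor `A` in the frame `(Z_i, 0)`, `(0, 1)`. -/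
def gram (q : M) : Matrix (Option ι) (Option ι) ℝ :=
  Matrix.of fun I J => D.A q (frameVec Z q I) (frameVec Z q J)

@[simp] theorem gram_some_some (q : M) (i j : ι) :
    D.gram Z q (some i) (some j) = D.γFun (Z i) (Z j) q := by
  simp [gram, frameVec, A_apply, γFun]

@[simp] theorem gram_some_none (q : M) (i : ι) :
    D.gram Z q (some i) none = D.ℓFun (Z i) q := by
  simp [gram, frameVec, A_apply, ℓFun]

@[simp] theorem gram_none_some (q : M) (i : ι) :
    D.gram Z q none (some i) = D.ℓFun (Z i) q := by
  simp [gram, frameVec, A_apply, ℓFun]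

@[simp] theorem gram_none_none (q : M) : D.gram Z q none none = D.ℓ₂ q := by
  simp [gram, frameVec, A_apply]

theorem gram_symm (q : M) (I J : Option ι) : D.gram Z q I J = D.gram Z q J I :=
  D.A_symm _ _

theorem contMDiffAt_gram {Z : ι → Π p : M, TangentSpace 𝓘(ℝ, E) p}
    (hZ : ∀ i, CMDiffAt ∞ (T% (Z i)) p) (I J : Option ι) :
    CMDiffAt ∞ (fun q => D.gram Z q I J) p := by
  rcases I with _ | i <;> rcases J with _ | j <;> simp only [gram_some_some, gram_some_none,
    gram_none_some, gram_none_none]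
  · exact D.smooth_ℓ₂.contMDiffAt
  · exact D.contMDiffAt_ℓFun (hZ j)
  · exact D.contMDiffAt_ℓFun (hZ i)
  · exact D.contMDiffAt_γFun (hZ i) (hZ j)

variable [Fintype ι] [DecidableEq ι]

/-- A left null vector of the Gram matrix would give a combination of the frame that is
`A`-orthogonal to a spanning set, hence zero, against linear independence. -/
theorem det_gram_ne_zero {Z : ι → Π p : M, TangentSpace 𝓘(ℝ, E) p}
    (b : Module.Basis ι ℝ (TangentSpace 𝓘(ℝ, E) p)) (hb : ∀ i, Z i p = b i) :
    (D.gram Z p).det ≠ 0 := by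
  intro h
  obtain ⟨c, hc, hc'⟩ := Matrix.exists_vecMul_eq_zero_iff.2 h
  have hA : ∀ J, D.A p (∑ I, c I • frameVec Z p I) (frameVec Z p J) = 0 := fun J => by
    rw [map_sum, LinearMap.sum_apply]
    simpa [Matrix.vecMul, dotProduct, gram] using congrFun hc' J
  have hu : ∑ I, c I • frameVec Z p I = 0 := by
    refine (D.A_nondegenerate p).1 _ fun z => ?_
    have hz : z = ∑ i, b.repr z.1 i • frameVec Z p (some i) + z.2 • frameVec Z p none := by
      refine Prod.ext ?_ ?_
      · simp [frameVec, hb, Prod.fst_sum, Module.Basis.sum_repr]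
      · simp [frameVec, Prod.snd_sum]
    rw [hz, map_add, map_sum, map_smul, hA, smul_zero, add_zero]
    exact Finset.sum_eq_zero fun i _ => by rw [map_smul, hA, smul_zero]
  refine hc (funext fun I => ?_)
  rw [Fintype.sum_option] at hu
  rcases I with _ | i
  · simpa [frameVec, Prod.snd_sum] using congrArg Prod.snd hu
  · have h1 : ∑ i, c (some i) • b i = 0 := by
      simpa [frameVec, Prod.fst_sum, hb] using congrArg Prod.fst hu
    exact Fintype.linearIndependent_iff.1 b.linearIndependent (fun i => c (some i)) h1 i

theorem eventually_det_gram_ne_zero {Z : ι → Π p : M, TangentSpace 𝓘(ℝ, E) p}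
    (hZ : ∀ i, CMDiffAt ∞ (T% (Z i)) p) (h0 : (D.gram Z p).det ≠ 0) :
    ∀ᶠ q in 𝓝 p, (D.gram Z q).det ≠ 0 :=
  (contMDiffAt_matrix_det (D.contMDiffAt_gram hZ)).continuousAt.eventually_ne h0

theorem inv_gram_symm (q : M) (I J : Option ι) :
    (D.gram Z q)⁻¹ I J = (D.gram Z q)⁻¹ J I := by
  have : (D.gram Z q).transpose = D.gram Z q := by
    ext I J; exact D.gram_symm Z q J I
  conv_lhs => rw [← this, ← Matrix.transpose_nonsing_inv]
  rfl

/-- Recovers a vector of `T_qM × ℝ` from its pairings, with coefficients that are smooth whenever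
the pairings are. All later expansions in a frame, of `n`, of a vector field or of `∇_V Z_i`, are
instances. -/
theorem eq_sum_frameVec (hcard : Fintype.card ι = Module.finrank ℝ E) {q : M}
    (h0 : (D.gram Z q).det ≠ 0) (u : TangentSpace 𝓘(ℝ, E) q × ℝ) :
    u = ∑ I, (∑ J, D.A q u (frameVec Z q J) * (D.gram Z q)⁻¹ J I) • frameVec Z q I := by
  have hA : ∀ (c : Option ι → ℝ) J, D.A q (∑ I, c I • frameVec Z q I) (frameVec Z q J)
      = Matrix.vecMul c (D.gram Z q) J := fun c J => by
    rw [map_sum, LinearMap.sum_apply]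
    simp [Matrix.vecMul, dotProduct, gram]
  -- Invertibility of the Gram matrix already forces independence, so the `Z_i` need not be known to
  -- be a basis at `q`.
  have hli : LinearIndependent ℝ (frameVec Z q) := by
    rw [Fintype.linearIndependent_iff]
    intro c hc
    refine congrFun (Matrix.eq_zero_of_vecMul_eq_zero h0 (funext fun J => ?_))
    rw [← hA c J, hc, map_zero]
    rfl
  have hcard' : Fintype.card (Option ι) = Module.finrank ℝ (TangentSpace 𝓘(ℝ, E) q × ℝ) := by
    rw [Module.finrank_prod, Fintype.card_option, hcard, Module.finrank_self]
    rfl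
  obtain ⟨c, rfl⟩ : ∃ c : Option ι → ℝ, ∑ I, c I • frameVec Z q I = u := by
    let B := basisOfLinearIndependentOfCardEqFinrank hli hcard'
    refine ⟨B.repr u, ?_⟩
    have := B.sum_repr u
    simpa [B] using this
  refine Finset.sum_congr rfl fun I _ => ?_
  congr 1
  have h1 : Matrix.vecMul (Matrix.vecMul c (D.gram Z q)) (D.gram Z q)⁻¹ = c := by
    rw [Matrix.vecMul_vecMul, Matrix.mul_nonsing_inv _ (isUnit_iff_ne_zero.2 h0), Matrix.vecMul_one]
  rw [← congrFun h1 I]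
  simp only [hA]
  rfl

/-- By `A_n`, the vector `(n, n⁽²⁾)` is orthogonal to every `(Z_i, 0)` and pairs to one with
`(0,1)`, so only the row `none` of the inverse survives. -/
theorem n_eq_sum (hcard : Fintype.card ι = Module.finrank ℝ E) {q : M}
    (h0 : (D.gram Z q).det ≠ 0) : D.n q = ∑ i, (D.gram Z q)⁻¹ none (some i) • Z i q := by
  have h := congrArg Prod.fst (D.eq_sum_frameVec Z hcard h0 (D.n q, D.n₂ q))
  simp only [D.A_n] at h
  simpa [Fintype.sum_option, frameVec, Prod.fst_sum] using h

theorem n₂_eq (hcard : Fintype.card ι = Module.finrank ℝ E) {q : M}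
    (h0 : (D.gram Z q).det ≠ 0) : D.n₂ q = (D.gram Z q)⁻¹ none none := by
  have h := congrArg Prod.snd (D.eq_sum_frameVec Z hcard h0 (D.n q, D.n₂ q))
  simp only [D.A_n] at h
  simpa [Fintype.sum_option, frameVec, Prod.snd_sum] using h

end Gram

end MetricData

section Bracket

variable {E : Type*} [NormedAddCommGroup E] [NormedSpace ℝ E] [FiniteDimensional ℝ E]
  {M : Type*} [TopologicalSpace M] [ChartedSpace E M] [IsManifold 𝓘(ℝ, E) ∞ M]
  {X Y Z W : Π p : M, TangentSpace 𝓘(ℝ, E) p} {f g : M → ℝ} {p : M}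

/-! ### Pointwise rules for the Lie bracket -/

theorem lieBracket_add_left (hX : MDiffAt (T% X) p) (hY : MDiffAt (T% Y) p) :
    mlieBracket 𝓘(ℝ, E) (X + Y) Z p
      = mlieBracket 𝓘(ℝ, E) X Z p + mlieBracket 𝓘(ℝ, E) Y Z p := by
  have : CompleteSpace E := FiniteDimensional.complete ℝ E
  exact mlieBracket_add_left hX hY

theorem lieBracket_add_right (hX : MDiffAt (T% X) p) (hY : MDiffAt (T% Y) p) :
    mlieBracket 𝓘(ℝ, E) Z (X + Y) p
      = mlieBracket 𝓘(ℝ, E) Z X p + mlieBracket 𝓘(ℝ, E) Z Y p := by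
  have : CompleteSpace E := FiniteDimensional.complete ℝ E
  exact mlieBracket_add_right hX hY

theorem lieBracket_smul_left (hf : MDiffAt f p) (hX : MDiffAt (T% X) p) :
    mlieBracket 𝓘(ℝ, E) (f • X) Z p
      = -along Z f p • X p + f p • mlieBracket 𝓘(ℝ, E) X Z p := by
  have : CompleteSpace E := FiniteDimensional.complete ℝ E
  exact mlieBracket_smul_left hf hX

theorem lieBracket_smul_right (hf : MDiffAt f p) (hX : MDiffAt (T% X) p) :
    mlieBracket 𝓘(ℝ, E) Z (f • X) p
      = along Z f p • X p + f p • mlieBracket 𝓘(ℝ, E) Z X p := by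
  have : CompleteSpace E := FiniteDimensional.complete ℝ E
  exact mlieBracket_smul_right hf hX

theorem lieBracket_swap : mlieBracket 𝓘(ℝ, E) X Y p = -mlieBracket 𝓘(ℝ, E) Y X p :=
  mlieBracket_swap_apply

theorem lieBracket_lieBracket (hX : CMDiffAt ∞ (T% X) p) (hY : CMDiffAt ∞ (T% Y) p)
    (hZ : CMDiffAt ∞ (T% Z) p) :
    mlieBracket 𝓘(ℝ, E) X (mlieBracket 𝓘(ℝ, E) Y Z) p
      = mlieBracket 𝓘(ℝ, E) (mlieBracket 𝓘(ℝ, E) X Y) Z p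
        + mlieBracket 𝓘(ℝ, E) Y (mlieBracket 𝓘(ℝ, E) X Z) p := by
  have : CompleteSpace E := FiniteDimensional.complete ℝ E
  have : IsManifold 𝓘(ℝ, E) (minSmoothness ℝ 3) M := by
    rw [minSmoothness_of_isRCLikeNormedField]; infer_instance
  have h2 : minSmoothness ℝ 2 ≤ (∞ : ℕ∞ω) := by
    rw [minSmoothness_of_isRCLikeNormedField]
    exact (mod_cast le_top : ((2 : ℕ∞) : ℕ∞ω) ≤ ∞)
  exact leibniz_identity_mlieBracket_apply (hX.of_le h2) (hY.of_le h2) (hZ.of_le h2)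

theorem mdifferentiableAt_smul (hf : MDiffAt f p) (hX : MDiffAt (T% X) p) :
    MDiffAt (T% (f • X)) p := hf.smul_section hX

theorem contMDiffAt_smul (hf : CMDiffAt ∞ f p) (hX : CMDiffAt ∞ (T% X) p) :
    CMDiffAt ∞ (T% (f • X)) p := hf.smul_section hX

theorem mdifferentiableAt_add (hX : MDiffAt (T% X) p) (hY : MDiffAt (T% Y) p) :
    MDiffAt (T% (X + Y)) p := mdifferentiableAt_add_section hX hY

end Bracket

/-! ### Commutators of derivations from the Jacobi identity. -/

section Commutator

variable {E : Type*} [NormedAddCommGroup E] [NormedSpace ℝ E] [FiniteDimensional ℝ E]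
  {M : Type*} [TopologicalSpace M] [ChartedSpace E M] [IsManifold 𝓘(ℝ, E) ∞ M]

/-- The Lie bracket acts on functions as the commutator of derivations. -/
theorem along_lieBracket (X Y : VectorFields E M) {f : M → ℝ} (hf : CMDiff ∞ f)
    [T2Space M] (p : M) :
    along (mlieBracket 𝓘(ℝ, E) X Y) f p = along X (along Y f) p - along Y (along X f) p := by
  have hX : ∀ q, CMDiffAt ∞ (T% (X : Π p : M, TangentSpace 𝓘(ℝ, E) p)) q :=
    fun q => X.contMDiff.contMDiffAt
  have hY : ∀ q, CMDiffAt ∞ (T% (Y : Π p : M, TangentSpace 𝓘(ℝ, E) p)) q :=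
    fun q => Y.contMDiff.contMDiffAt
  -- The Jacobi identity for `X`, `Y`, `f • Z` carries the claim as its coefficient of `Z p`, so a
  -- `Z` with `Z p ≠ 0` is needed. If `T_pM = 0`, every term vanishes.
  by_cases hE : ∃ v : TangentSpace 𝓘(ℝ, E) p, v ≠ 0
  · obtain ⟨v, hv⟩ := hE
    obtain ⟨Z, rfl⟩ := evalAt_surjective p v
    change Z p ≠ 0 at hv
    have hZ : ∀ q, CMDiffAt ∞ (T% (Z : Π p : M, TangentSpace 𝓘(ℝ, E) p)) q :=
      fun q => Z.contMDiff.contMDiffAt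
    have key : ∀ V : VectorFields E M, mlieBracket 𝓘(ℝ, E) V (f • ⇑Z)
        = along V f • ⇑Z + f • mlieBracket 𝓘(ℝ, E) V Z := fun V => by
      ext q
      exact lieBracket_smul_right hf.contMDiffAt.mdiffAt Z.mdifferentiableAt
    have hf' := fun q => hf.contMDiffAt (x := q)
    have m : ∀ V W : VectorFields E M, mlieBracket 𝓘(ℝ, E) V (mlieBracket 𝓘(ℝ, E) W (f • ⇑Z)) p
        = along V (along W f) p • Z p + along W f p • mlieBracket 𝓘(ℝ, E) V Z p
          + (along V f p • mlieBracket 𝓘(ℝ, E) W Z p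
          + f p • mlieBracket 𝓘(ℝ, E) V (mlieBracket 𝓘(ℝ, E) W Z) p) := fun V W => by
      have hW := contMDiffAt_along W.contMDiff.contMDiffAt (hf' p)
      have hWZ := contMDiffAt_mlieBracket (X := W) (Y := Z) W.contMDiff.contMDiffAt (hZ p)
      rw [key, lieBracket_add_right (mdifferentiableAt_smul hW.mdiffAt Z.mdifferentiableAt)
        (mdifferentiableAt_smul (hf' p).mdiffAt (hWZ.mdifferentiableAt (by simp))),
        lieBracket_smul_right hW.mdiffAt Z.mdifferentiableAt,
        lieBracket_smul_right (hf' p).mdiffAt (hWZ.mdifferentiableAt (by simp))]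
    -- Substituting the identity for `X`, `Y`, `Z` into the one for `X`, `Y`, `f • Z` removes all
    -- terms without second derivatives of `f`, except the bracket acting on `f`.
    have hJ := lieBracket_lieBracket (hX p) (hY p) (contMDiffAt_smul (hf' p) (hZ p))
    have hJ' := lieBracket_lieBracket (hX p) (hY p) (hZ p)
    rw [m, m, lieBracket_smul_right (hf' p).mdiffAt Z.mdifferentiableAt, hJ'] at hJ
    have h0 : (along (mlieBracket 𝓘(ℝ, E) X Y) f p
        - (along X (along Y f) p - along Y (along X f) p)) • Z p = 0 := by
      linear_combination (norm := module) -hJ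
    exact sub_eq_zero.1 ((smul_eq_zero.1 h0).resolve_right hv)
  · push Not at hE
    simp only [along, hE, map_zero, sub_zero]

end Commutator

namespace MetricData

variable {E : Type*} [NormedAddCommGroup E] [NormedSpace ℝ E] [FiniteDimensional ℝ E]
  {M : Type*} [TopologicalSpace M] [ChartedSpace E M] [IsManifold 𝓘(ℝ, E) ∞ M]
  (D : MetricData E M)
  {X X' Y Y' : Π p : M, TangentSpace 𝓘(ℝ, E) p} {f : M → ℝ} {p : M}

/-! ### Smoothness of `n` and `n⁽²⁾` -/

theorem contMDiffAt_n_and_n₂ (p : M) : CMDiffAt ∞ (T% D.n) p ∧ CMDiffAt ∞ D.n₂ p := by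
  let b := Module.finBasis ℝ (TangentSpace 𝓘(ℝ, E) p)
  let Z := fun i => FiberBundle.extend E (b i)
  have hZ : ∀ i, CMDiffAt ∞ (T% (Z i)) p := fun i => FiberBundle.contMDiffAt_extend 𝓘(ℝ, E) E (b i)
  have hcard : Fintype.card (Fin (Module.finrank ℝ (TangentSpace 𝓘(ℝ, E) p)))
      = Module.finrank ℝ E := by rw [Fintype.card_fin]; rfl
  have h0 := D.det_gram_ne_zero (Z := Z) b fun i => by simp [Z]
  have hev := D.eventually_det_gram_ne_zero hZ h0
  have hH := contMDiffAt_matrix_inv (D.contMDiffAt_gram hZ) h0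
  constructor
  · have h1 : CMDiffAt ∞ (T% (fun q => ∑ i, (D.gram Z q)⁻¹ none (some i) • Z i q)) p :=
      ContMDiffAt.sum_section fun i _ => (hH none (some i)).smul_section (hZ i)
    refine h1.congr_of_eventuallyEq ?_
    filter_upwards [hev] with q hq
    rw [D.n_eq_sum Z hcard hq]
  · refine (hH none none).congr_of_eventuallyEq ?_
    filter_upwards [hev] with q hq
    rw [D.n₂_eq Z hcard hq]

theorem contMDiffAt_n : CMDiffAt ∞ (T% D.n) p := (D.contMDiffAt_n_and_n₂ p).1

theorem contMDiffAt_n₂ : CMDiffAt ∞ D.n₂ p := (D.contMDiffAt_n_and_n₂ p).2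

theorem mdifferentiableAt_n : MDiffAt (T% D.n) p := D.contMDiffAt_n.mdifferentiableAt (by simp)

theorem contMDiffAt_ℓ₂ : CMDiffAt ∞ D.ℓ₂ p := D.smooth_ℓ₂.contMDiffAt

/-! ### The tensors `U` and `F` -/

theorem U_comm : D.U X Y p = D.U Y X p := by
  rw [U, U, D.γFun_comm (X := Y) (Y := X), D.γFun_comm (X := mlieBracket 𝓘(ℝ, E) D.n Y) (Y := X),
    D.γFun_comm (X := Y) (Y := mlieBracket 𝓘(ℝ, E) D.n X)]
  ring

theorem U_add_left (hX : MDiffAt (T% X) p) (hX' : MDiffAt (T% X') p) (hY : MDiffAt (T% Y) p) :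
    D.U (X + X') Y p = D.U X Y p + D.U X' Y p := by
  simp only [U, D.γFun_add_left, D.ℓFun_add, along_vec_add, Pi.add_apply]
  rw [along_add (D.mdifferentiableAt_γFun hX hY) (D.mdifferentiableAt_γFun hX' hY)]
  simp only [γFun, lieBracket_add_right hX hX', map_add, add_apply]
  ring

/-- The term `n(f) γ(X,Y)` from the derivative of `γ(fX,Y)` is cancelled by the one from `[n, fX]`.
-/
theorem U_smul_left (hf : MDiffAt f p) (hX : MDiffAt (T% X) p) (hY : MDiffAt (T% Y) p) :
    D.U (f • X) Y p = f p * D.U X Y p := by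
  simp only [U, D.γFun_smul_left, D.ℓFun_smul, along_vec_smul, Pi.mul_apply]
  rw [along_mul hf (D.mdifferentiableAt_γFun hX hY)]
  simp only [γFun, lieBracket_smul_right hf hX, map_add, map_smul, add_apply, smul_apply,
    smul_eq_mul]
  ring

theorem U_add_right (hX : MDiffAt (T% X) p) (hX' : MDiffAt (T% X') p) (hY : MDiffAt (T% Y) p) :
    D.U Y (X + X') p = D.U Y X p + D.U Y X' p := by
  rw [D.U_comm, D.U_add_left hX hX' hY, D.U_comm, D.U_comm (X := X')]

theorem U_smul_right (hf : MDiffAt f p) (hX : MDiffAt (T% X) p) (hY : MDiffAt (T% Y) p) :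
    D.U Y (f • X) p = f p * D.U Y X p := by
  rw [D.U_comm, D.U_smul_left hf hX hY, D.U_comm]

theorem contMDiffAt_U (hX : CMDiffAt ∞ (T% X) p) (hY : CMDiffAt ∞ (T% Y) p) :
    CMDiffAt ∞ (D.U X Y) p := by
  have hn := D.contMDiffAt_n (p := p)
  exact (contMDiffAt_const.mul (((contMDiffAt_along hn (D.contMDiffAt_γFun hX hY)).sub
    (D.contMDiffAt_γFun (contMDiffAt_mlieBracket hn hX) hY)).sub
    (D.contMDiffAt_γFun hX (contMDiffAt_mlieBracket hn hY)))).add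
    (contMDiffAt_const.mul (((D.contMDiffAt_ℓFun hX).mul
      (contMDiffAt_along hY D.contMDiffAt_n₂)).add
      ((contMDiffAt_along hX D.contMDiffAt_n₂).mul (D.contMDiffAt_ℓFun hY))))

theorem F_swap : D.F X Y p = -D.F Y X p := by
  simp only [F, dOneForm, ℓFun]
  rw [lieBracket_swap, map_neg]
  ring

theorem F_add_left (hX : MDiffAt (T% X) p) (hX' : MDiffAt (T% X') p) :
    D.F (X + X') Y p = D.F X Y p + D.F X' Y p := by
  simp only [F, dOneForm, D.ℓFun_add, along_vec_add]
  rw [along_add (D.mdifferentiableAt_ℓFun hX) (D.mdifferentiableAt_ℓFun hX')]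
  simp only [ℓFun, lieBracket_add_left hX hX', map_add]
  ring

theorem F_smul_left (hf : MDiffAt f p) (hX : MDiffAt (T% X) p) :
    D.F (f • X) Y p = f p * D.F X Y p := by
  simp only [F, dOneForm, D.ℓFun_smul, along_vec_smul]
  rw [along_mul hf (D.mdifferentiableAt_ℓFun hX)]
  simp only [ℓFun, lieBracket_smul_left hf hX, map_add, map_smul, smul_eq_mul]
  ring

/-- Allows `F(n, Y)` to be computed pointwise from the expansion of `n` in a frame, although `F` is
defined through derivatives. -/
theorem tensorialAt_F (Y : Π p : M, TangentSpace 𝓘(ℝ, E) p) (p : M) :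
    TensorialAt 𝓘(ℝ, E) E (fun X => D.F X Y p) p where
  smul hf hX := D.F_smul_left hf hX
  add hX hX' := D.F_add_left hX hX'

theorem contMDiffAt_F (hX : CMDiffAt ∞ (T% X) p) (hY : CMDiffAt ∞ (T% Y) p) :
    CMDiffAt ∞ (D.F X Y) p :=
  contMDiffAt_const.mul (((contMDiffAt_along hX (D.contMDiffAt_ℓFun hY)).sub
    (contMDiffAt_along hY (D.contMDiffAt_ℓFun hX))).sub
    (D.contMDiffAt_ℓFun (contMDiffAt_mlieBracket hX hY)))

end MetricData

namespace MetricData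

variable {E : Type*} [NormedAddCommGroup E] [NormedSpace ℝ E] [FiniteDimensional ℝ E]
  {M : Type*} [TopologicalSpace M] [ChartedSpace E M] [IsManifold 𝓘(ℝ, E) ∞ M]
  (D : MetricData E M)
  {X X' σ σ' W W' : Π p : M, TangentSpace 𝓘(ℝ, E) p} {f : M → ℝ} {p : M}

/-! ### Koszul formulas -/

/-- The Koszul expression for `γ(∇_X σ, W)`. -/
def koszulγ (X σ W : Π p : M, TangentSpace 𝓘(ℝ, E) p) (p : M) : ℝ :=
  1 / 2 * (along X (D.γFun σ W) p + along σ (D.γFun X W) p - along W (D.γFun X σ) p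
    + D.γFun (mlieBracket 𝓘(ℝ, E) X σ) W p - D.γFun (mlieBracket 𝓘(ℝ, E) X W) σ p
    - D.γFun (mlieBracket 𝓘(ℝ, E) σ W) X p) + D.U X σ p * D.ℓFun W p

/-- The Koszul expression for `ℓ(∇_X σ)`. -/
def koszulℓ (X σ : Π p : M, TangentSpace 𝓘(ℝ, E) p) (p : M) : ℝ :=
  1 / 2 * (along X (D.ℓFun σ) p + along σ (D.ℓFun X) p + D.ℓFun (mlieBracket 𝓘(ℝ, E) X σ) p)
    + D.ℓ₂ p * D.U X σ p

theorem koszulγ_add_left (hX : MDiffAt (T% X) p) (hX' : MDiffAt (T% X') p)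
    (hσ : MDiffAt (T% σ) p) (hW : MDiffAt (T% W) p) :
    D.koszulγ (X + X') σ W p = D.koszulγ X σ W p + D.koszulγ X' σ W p := by
  simp only [koszulγ, along_vec_add, D.γFun_add_left, D.U_add_left hX hX' hσ]
  rw [along_add (D.mdifferentiableAt_γFun hX hW) (D.mdifferentiableAt_γFun hX' hW),
    along_add (D.mdifferentiableAt_γFun hX hσ) (D.mdifferentiableAt_γFun hX' hσ)]
  simp only [γFun, lieBracket_add_left hX hX', Pi.add_apply, map_add, add_apply]
  ring

theorem koszulγ_add_right (hX : MDiffAt (T% X) p) (hσ : MDiffAt (T% σ) p) (hW : MDiffAt (T% W) p)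
    (hW' : MDiffAt (T% W') p) :
    D.koszulγ X σ (W + W') p = D.koszulγ X σ W p + D.koszulγ X σ W' p := by
  simp only [koszulγ, along_vec_add, D.γFun_add_right, D.ℓFun_add, Pi.add_apply]
  rw [along_add (D.mdifferentiableAt_γFun hX hW) (D.mdifferentiableAt_γFun hX hW'),
    along_add (D.mdifferentiableAt_γFun hσ hW) (D.mdifferentiableAt_γFun hσ hW')]
  simp only [γFun, lieBracket_add_right hW hW', map_add, add_apply]
  ring

theorem koszulγ_add_middle (hX : MDiffAt (T% X) p) (hσ : MDiffAt (T% σ) p)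
    (hσ' : MDiffAt (T% σ') p) (hW : MDiffAt (T% W) p) :
    D.koszulγ X (σ + σ') W p = D.koszulγ X σ W p + D.koszulγ X σ' W p := by
  simp only [koszulγ, along_vec_add, D.γFun_add_left, D.γFun_add_right, D.U_add_right hσ hσ' hX]
  rw [along_add (D.mdifferentiableAt_γFun hX hσ) (D.mdifferentiableAt_γFun hX hσ'),
    along_add (D.mdifferentiableAt_γFun hσ hW) (D.mdifferentiableAt_γFun hσ' hW)]
  simp only [γFun, lieBracket_add_left hσ hσ', lieBracket_add_right hσ hσ', Pi.add_apply, map_add,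
    add_apply]
  ring

theorem koszulγ_smul_left (hf : MDiffAt f p) (hX : MDiffAt (T% X) p)
    (hσ : MDiffAt (T% σ) p) (hW : MDiffAt (T% W) p) :
    D.koszulγ (f • X) σ W p = f p * D.koszulγ X σ W p := by
  simp only [koszulγ, along_vec_smul, D.γFun_smul_left, D.U_smul_left hf hX hσ]
  rw [along_mul hf (D.mdifferentiableAt_γFun hX hW), along_mul hf (D.mdifferentiableAt_γFun hX hσ)]
  simp only [γFun, lieBracket_smul_left hf hX, Pi.smul_apply', map_add, map_smul, add_apply,
    smul_apply, smul_eq_mul]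
  ring

theorem koszulγ_smul_right (hf : MDiffAt f p) (hX : MDiffAt (T% X) p)
    (hσ : MDiffAt (T% σ) p) (hW : MDiffAt (T% W) p) :
    D.koszulγ X σ (f • W) p = f p * D.koszulγ X σ W p := by
  simp only [koszulγ, along_vec_smul, D.γFun_smul_right, D.ℓFun_smul]
  rw [along_mul hf (D.mdifferentiableAt_γFun hX hW), along_mul hf (D.mdifferentiableAt_γFun hσ hW)]
  simp only [γFun, lieBracket_smul_right hf hW, map_add, map_smul, add_apply,
    smul_apply, smul_eq_mul, Pi.mul_apply, D.symm p (W p) (X p), D.symm p (W p) (σ p)]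
  ring

/-- This slot is not tensorial: the extra term is the Leibniz rule of the covariant derivative,
paired with `W`. -/
theorem koszulγ_smul_middle (hf : MDiffAt f p) (hX : MDiffAt (T% X) p)
    (hσ : MDiffAt (T% σ) p) (hW : MDiffAt (T% W) p) :
    D.koszulγ X (f • σ) W p = f p * D.koszulγ X σ W p + along X f p * D.γFun σ W p := by
  simp only [koszulγ, along_vec_smul, D.γFun_smul_left, D.γFun_smul_right, Pi.mul_apply,
    D.U_smul_right hf hσ hX]
  rw [along_mul hf (D.mdifferentiableAt_γFun hσ hW), along_mul hf (D.mdifferentiableAt_γFun hX hσ)]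
  simp only [γFun, lieBracket_smul_left hf hσ, lieBracket_smul_right hf hσ,
    map_add, map_smul, add_apply, smul_apply, smul_eq_mul, D.symm p (σ p) (X p)]
  ring

theorem koszulℓ_add_left (hX : MDiffAt (T% X) p) (hX' : MDiffAt (T% X') p)
    (hσ : MDiffAt (T% σ) p) :
    D.koszulℓ (X + X') σ p = D.koszulℓ X σ p + D.koszulℓ X' σ p := by
  simp only [koszulℓ, along_vec_add, D.ℓFun_add, D.U_add_left hX hX' hσ]
  rw [along_add (D.mdifferentiableAt_ℓFun hX) (D.mdifferentiableAt_ℓFun hX')]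
  simp only [ℓFun, lieBracket_add_left hX hX', map_add]
  ring

theorem koszulℓ_add_right (hX : MDiffAt (T% X) p) (hσ : MDiffAt (T% σ) p)
    (hσ' : MDiffAt (T% σ') p) :
    D.koszulℓ X (σ + σ') p = D.koszulℓ X σ p + D.koszulℓ X σ' p := by
  simp only [koszulℓ, along_vec_add, D.ℓFun_add, D.U_add_right hσ hσ' hX]
  rw [along_add (D.mdifferentiableAt_ℓFun hσ) (D.mdifferentiableAt_ℓFun hσ')]
  simp only [ℓFun, lieBracket_add_right hσ hσ', map_add]
  ring

theorem koszulℓ_smul_left (hf : MDiffAt f p) (hX : MDiffAt (T% X) p) (hσ : MDiffAt (T% σ) p) :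
    D.koszulℓ (f • X) σ p = f p * D.koszulℓ X σ p := by
  simp only [koszulℓ, along_vec_smul, D.ℓFun_smul, D.U_smul_left hf hX hσ]
  rw [along_mul hf (D.mdifferentiableAt_ℓFun hX)]
  simp only [ℓFun, lieBracket_smul_left hf hX, map_add, map_smul, smul_eq_mul]
  ring

theorem koszulℓ_smul_right (hf : MDiffAt f p) (hX : MDiffAt (T% X) p) (hσ : MDiffAt (T% σ) p) :
    D.koszulℓ X (f • σ) p = f p * D.koszulℓ X σ p + along X f p * D.ℓFun σ p := by
  simp only [koszulℓ, along_vec_smul, D.ℓFun_smul, D.U_smul_right hf hσ hX]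
  rw [along_mul hf (D.mdifferentiableAt_ℓFun hσ)]
  simp only [ℓFun, lieBracket_smul_right hf hσ, map_add, map_smul, smul_eq_mul]
  ring

/-- The Koszul expressions are compatible: this is where the definition of `U` enters. -/
theorem koszulγ_n_add (hX : MDiffAt (T% X) p) (hσ : MDiffAt (T% σ) p) :
    D.koszulγ X σ D.n p + D.n₂ p * D.koszulℓ X σ p = 0 := by
  have hn₂ : MDiffAt D.n₂ p := D.contMDiffAt_n₂.mdiffAt
  have hneg : ∀ {V Y : Π p : M, TangentSpace 𝓘(ℝ, E) p}, MDiffAt (T% Y) p →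
      along V (D.γFun Y D.n) p
        -- Derivative of the identity `γ(Y,n) = -n⁽²⁾ ℓ(Y)`.
        = -(D.n₂ p * along V (D.ℓFun Y) p + D.ℓFun Y p * along V D.n₂ p) := fun hY => by
    rw [← along_mul hn₂ (D.mdifferentiableAt_ℓFun hY), D.γFun_n, along, mvfderiv_neg]
    rfl
  have hsw : ∀ V Y : Π p : M, TangentSpace 𝓘(ℝ, E) p,
      D.γFun (mlieBracket 𝓘(ℝ, E) V D.n) Y p = -D.γFun (mlieBracket 𝓘(ℝ, E) D.n V) Y p :=
    fun V Y => by
      simp only [γFun]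
      rw [lieBracket_swap, map_neg, neg_apply]
  have hl : D.ℓFun D.n p = 1 - D.n₂ p * D.ℓ₂ p := D.ℓ_n
  have hb : D.γFun (mlieBracket 𝓘(ℝ, E) X σ) D.n p
      = -(D.n₂ p * D.ℓFun (mlieBracket 𝓘(ℝ, E) X σ) p) := congrFun D.γFun_n p
  -- In `koszulγ X σ n` the terms along `n` form `-½ (£_n γ)(X,σ)`. Together with the derivatives of
  -- `n⁽²⁾` they make `-U(X,σ)`, which cancels the `1` in `ℓ(n) = 1 - n⁽²⁾ ℓ⁽²⁾`; what remains is
  -- `-n⁽²⁾` times `koszulℓ X σ`.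
  rw [koszulγ, koszulℓ, hneg hσ, hneg hX, hsw, hsw, hl, hb, U,
    D.γFun_comm (X := X) (Y := mlieBracket 𝓘(ℝ, E) D.n σ)]
  ring

/-- The vector `∇_X σ` determined by the Koszul expressions, as a linear function of `X`. -/
theorem exists_koszul (hσ : MDiffAt (T% σ) p) :
    ∃ T : TangentSpace 𝓘(ℝ, E) p →L[ℝ] TangentSpace 𝓘(ℝ, E) p,
      ∀ X : Π p : M, TangentSpace 𝓘(ℝ, E) p, MDiffAt (T% X) p →
        (∀ W : Π p : M, TangentSpace 𝓘(ℝ, E) p, MDiffAt (T% W) p →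
          D.γ p (T (X p)) (W p) = D.koszulγ X σ W p) ∧
        D.ℓ p (T (X p)) = D.koszulℓ X σ p := by
  have t1 : ∀ W : Π p : M, TangentSpace 𝓘(ℝ, E) p, MDiffAt (T% W) p →
      TensorialAt 𝓘(ℝ, E) E (fun X => D.koszulγ X σ W p) p := fun W hW =>
    ⟨fun hf hX => D.koszulγ_smul_left hf hX hσ hW, fun hX hX' => D.koszulγ_add_left hX hX' hσ hW⟩
  have t2 : ∀ X : Π p : M, TangentSpace 𝓘(ℝ, E) p, MDiffAt (T% X) p →
      TensorialAt 𝓘(ℝ, E) E (fun W => D.koszulγ X σ W p) p := fun X hX =>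
    ⟨fun hf hW => D.koszulγ_smul_right hf hX hσ hW, fun hW hW' => D.koszulγ_add_right hX hσ hW hW'⟩
  have t3 : TensorialAt 𝓘(ℝ, E) E (fun X => D.koszulℓ X σ p) p :=
    ⟨fun hf hX => D.koszulℓ_smul_left hf hX hσ, fun hX hX' => D.koszulℓ_add_left hX hX' hσ⟩
  let B := TensorialAt.mkHom₂ (fun X W => D.koszulγ X σ W p) p t1 t2
  let L := TensorialAt.mkHom (fun X => D.koszulℓ X σ p) p t3
  have hB : ∀ {X W : Π p : M, TangentSpace 𝓘(ℝ, E) p}, MDiffAt (T% X) p → MDiffAt (T% W) p →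
      B (X p) (W p) = D.koszulγ X σ W p := fun hX hW => TensorialAt.mkHom₂_apply t1 t2 hX hW
  have hL : ∀ {X : Π p : M, TangentSpace 𝓘(ℝ, E) p}, MDiffAt (T% X) p →
      L (X p) = D.koszulℓ X σ p := fun hX => TensorialAt.mkHom_apply t3 hX
  -- `Φ v` prescribes the pairings with `(w,b)`, and `u v` is the vector of `T_pM × ℝ` that realises
  -- them through `A`.
  let Φ : TangentSpace 𝓘(ℝ, E) p →ₗ[ℝ] Module.Dual ℝ (TangentSpace 𝓘(ℝ, E) p × ℝ) :=
    { toFun := fun v => (B v : TangentSpace 𝓘(ℝ, E) p →ₗ[ℝ] ℝ) ∘ₗ LinearMap.fst ℝ _ ℝ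
        + L v • LinearMap.snd ℝ _ ℝ
      map_add' := fun v w => by ext <;> simp
      map_smul' := fun a v => by ext <;> simp }
  let u := fun v => ((D.A p).toDual (D.A_nondegenerate p)).symm (Φ v)
  have hu : ∀ v w b, D.A p (u v) (w, b) = B v w + b * L v := fun v w b => by
    rw [LinearMap.BilinForm.apply_toDual_symm_apply]
    simp [Φ, mul_comm]
  -- The `ℝ`-component of `u` is its pairing with `(n, n⁽²⁾)`, zero by compatibility of the Koszul
  -- expressions; hence `u` is a tangent vector.
  have hu2 : ∀ X : Π p : M, TangentSpace 𝓘(ℝ, E) p, MDiffAt (T% X) p → (u (X p)).2 = 0 :=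
    fun X hX => by
      rw [← D.A_n, D.A_symm, hu, hB hX D.mdifferentiableAt_n, hL hX, D.koszulγ_n_add hX hσ]
  have : T2Space (TangentSpace 𝓘(ℝ, E) p) := inferInstanceAs (T2Space E)
  refine ⟨LinearMap.toContinuousLinearMap (LinearMap.fst ℝ _ ℝ ∘ₗ
    (((D.A p).toDual (D.A_nondegenerate p)).symm : _ →ₗ[ℝ] _) ∘ₗ Φ), fun X hX => ?_⟩
  have h1 : ∀ w b, D.γ p (u (X p)).1 w + b * D.ℓ p (u (X p)).1 = B (X p) w + b * L (X p) :=
    fun w b => by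
      rw [← hu, ← Prod.mk.eta (p := u (X p)), hu2 X hX, A_apply]
      ring
  refine ⟨fun W hW => ?_, ?_⟩
  · have := h1 (W p) 0
    rw [zero_mul, zero_mul, add_zero, add_zero, hB hX hW] at this
    exact this
  · have := h1 0 1
    rw [map_zero, map_zero, zero_add, zero_add, one_mul, one_mul, hL hX] at this
    exact this

end MetricData

/-! ### Smoothness of endomorphism fields. -/

section HomBundle

variable {E : Type*} [NormedAddCommGroup E] [NormedSpace ℝ E] [FiniteDimensional ℝ E]
  {M : Type*} [TopologicalSpace M] [ChartedSpace E M] [IsManifold 𝓘(ℝ, E) ∞ M]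

theorem eventually_mdifferentiableAt {X : Π p : M, TangentSpace 𝓘(ℝ, E) p} {p : M}
    (hX : CMDiffAt ∞ (T% X) p) : ∀ᶠ q in 𝓝 p, MDiffAt (T% X) q := by
  -- Only regularity of finite order at a point spreads to a neighbourhood, hence the descent to
  -- order one.
  have h := (contMDiffAt_iff_contMDiffAt_nhds (by simp)).1 (hX.of_le (m := 1) (by simp))
  filter_upwards [h] with q hq
  exact hq.mdifferentiableAt (by simp)

/-- A section of `Hom(TM, TM)` is smooth if it maps smooth vector fields to smooth vector fields. -/
theorem contMDiffAt_hom_of_apply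
    {φ : Π p : M, TangentSpace 𝓘(ℝ, E) p →L[ℝ] TangentSpace 𝓘(ℝ, E) p} {p : M}
    (h : ∀ Z : Π p : M, TangentSpace 𝓘(ℝ, E) p, CMDiffAt ∞ (T% Z) p →
      CMDiffAt ∞ (T% (fun q => φ q (Z q))) p) :
    ContMDiffAt 𝓘(ℝ, E) (𝓘(ℝ, E).prod 𝓘(ℝ, E →L[ℝ] E)) ∞
      (fun q => TotalSpace.mk' (E →L[ℝ] E)
        (E := fun q : M => TangentSpace 𝓘(ℝ, E) q →L[ℝ] TangentSpace 𝓘(ℝ, E) q) q (φ q)) p := by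
  rw [contMDiffAt_hom_bundle]
  refine ⟨contMDiffAt_id, ?_⟩
  let e := trivializationAt E (TangentSpace 𝓘(ℝ, E) : M → Type _) p
  have he : p ∈ e.baseSet := FiberBundle.mem_baseSet_trivializationAt' p
  let b := Module.finBasis ℝ E
  -- The hypothesis is applied to the local field with constant coordinates `c`, which gives one
  -- column of the coordinate matrix.
  have hc : ∀ c : E, CMDiffAt ∞ (fun q => ContinuousLinearMap.inCoordinates E
      (TangentSpace 𝓘(ℝ, E)) E (TangentSpace 𝓘(ℝ, E)) p q p q (φ q) c) p := fun c => by
    have h1 := h (FiberBundle.extend E (e.symm p c)) (FiberBundle.contMDiffAt_extend 𝓘(ℝ, E) E _)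
    rw [contMDiffAt_section] at h1
    refine h1.congr_of_eventuallyEq ?_
    filter_upwards [e.open_baseSet.mem_nhds he] with q hq
    rw [ContinuousLinearMap.inCoordinates, ContinuousLinearMap.comp_apply,
      ContinuousLinearMap.comp_apply, Trivialization.symmL_apply _ hq,
      Trivialization.continuousLinearMapAt_apply, Trivialization.coe_linearMapAt_of_mem _ hq]
    have : e.symm q c = FiberBundle.extend E (e.symm p c) q := by
      simp only [FiberBundle.extend]
      rw [Trivialization.apply_mk_symm _ he]
    rw [this]
  have hsum : (fun q => ContinuousLinearMap.inCoordinates E (TangentSpace 𝓘(ℝ, E)) E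
      (TangentSpace 𝓘(ℝ, E)) p q p q (φ q)) = fun q => ∑ i,
      ContinuousLinearMap.smulRightL ℝ E E (LinearMap.toContinuousLinearMap (b.coord i))
        (ContinuousLinearMap.inCoordinates E
      (TangentSpace 𝓘(ℝ, E)) E (TangentSpace 𝓘(ℝ, E)) p q p q (φ q) (b i)) := by
    ext q v
    conv_lhs => rw [← b.sum_repr v, map_sum]
    simp
  change CMDiffAt ∞ (fun q => ContinuousLinearMap.inCoordinates E (TangentSpace 𝓘(ℝ, E)) E
      (TangentSpace 𝓘(ℝ, E)) p q p q (φ q)) p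
  rw [hsum]
  exact contMDiffAt_finsetSum fun i _ =>
    (ContinuousLinearMap.contMDiff _).contMDiffAt.comp p (hc (b i))

end HomBundle

namespace MetricData

variable {E : Type*} [NormedAddCommGroup E] [NormedSpace ℝ E] [FiniteDimensional ℝ E]
  {M : Type*} [TopologicalSpace M] [ChartedSpace E M] [IsManifold 𝓘(ℝ, E) ∞ M]
  (D : MetricData E M)
  {X X' σ σ' W W' : Π p : M, TangentSpace 𝓘(ℝ, E) p} {f : M → ℝ} {p : M}

/-! ### Existence of the metric hypersurface connection -/

open Classical in
/-- The covariant derivative determined by the Koszul expressions. -/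
def koszulCov (σ : Π p : M, TangentSpace 𝓘(ℝ, E) p) (p : M) :
    TangentSpace 𝓘(ℝ, E) p →L[ℝ] TangentSpace 𝓘(ℝ, E) p :=
  -- The value `0` at points of non-differentiability is harmless: the axioms of a covariant
  -- derivative only test differentiable sections.
  if h : MDiffAt (T% σ) p then (D.exists_koszul h).choose else 0

theorem γ_koszulCov (hX : MDiffAt (T% X) p) (hσ : MDiffAt (T% σ) p) (hW : MDiffAt (T% W) p) :
    D.γ p (D.koszulCov σ p (X p)) (W p) = D.koszulγ X σ W p := by
  rw [koszulCov, dif_pos hσ]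
  exact ((D.exists_koszul hσ).choose_spec X hX).1 W hW

theorem ℓ_koszulCov (hX : MDiffAt (T% X) p) (hσ : MDiffAt (T% σ) p) :
    D.ℓ p (D.koszulCov σ p (X p)) = D.koszulℓ X σ p := by
  rw [koszulCov, dif_pos hσ]
  exact ((D.exists_koszul hσ).choose_spec X hX).2

/-- A tangent vector is determined by its pairings with differentiable vector fields. -/
theorem ext_of_γ_of_ℓ' {v v' : TangentSpace 𝓘(ℝ, E) p}
    (h : ∀ W : Π p : M, TangentSpace 𝓘(ℝ, E) p, MDiffAt (T% W) p →
      D.γ p v (W p) = D.γ p v' (W p)) (h' : D.ℓ p v = D.ℓ p v') : v = v' :=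
  D.ext_of_γ_of_ℓ (fun w => by
    have := h (FiberBundle.extend E w) (FiberBundle.mdifferentiableAt_extend 𝓘(ℝ, E) E w)
    rwa [FiberBundle.extend_apply_self] at this) h'

/-- Both axioms are checked after pairing with `γ` and `ℓ`, where they become the additivity and
Leibniz rules of the Koszul expressions. -/
theorem isCovariantDerivativeOn_koszulCov :
    IsCovariantDerivativeOn (I := 𝓘(ℝ, E)) E D.koszulCov Set.univ where
  add {σ σ' p} hσ hσ' _ := by
    ext v
    obtain ⟨X, hX, rfl⟩ : ∃ X : Π p : M, TangentSpace 𝓘(ℝ, E) p, MDiffAt (T% X) p ∧ X p = v :=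
      ⟨FiberBundle.extend E v, FiberBundle.mdifferentiableAt_extend 𝓘(ℝ, E) E v, by simp⟩
    refine D.ext_of_γ_of_ℓ' (fun W hW => ?_) ?_
    · rw [D.γ_koszulCov hX (mdifferentiableAt_add hσ hσ') hW, add_apply, map_add, add_apply,
        D.γ_koszulCov hX hσ hW, D.γ_koszulCov hX hσ' hW, D.koszulγ_add_middle hX hσ hσ' hW]
    · rw [D.ℓ_koszulCov hX (mdifferentiableAt_add hσ hσ'), add_apply, map_add,
        D.ℓ_koszulCov hX hσ, D.ℓ_koszulCov hX hσ', D.koszulℓ_add_right hX hσ hσ']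
  leibniz {σ g p} hσ hg _ := by
    ext v
    obtain ⟨X, hX, rfl⟩ : ∃ X : Π p : M, TangentSpace 𝓘(ℝ, E) p, MDiffAt (T% X) p ∧ X p = v :=
      ⟨FiberBundle.extend E v, FiberBundle.mdifferentiableAt_extend 𝓘(ℝ, E) E v, by simp⟩
    refine D.ext_of_γ_of_ℓ' (fun W hW => ?_) ?_
    · rw [D.γ_koszulCov hX (mdifferentiableAt_smul hg hσ) hW, add_apply, map_add, add_apply,
        smul_apply, map_smul, smul_apply, D.γ_koszulCov hX hσ hW,
        D.koszulγ_smul_middle hg hX hσ hW, ContinuousLinearMap.smulRight_apply, map_smul,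
        smul_apply]
      rfl
    · rw [D.ℓ_koszulCov hX (mdifferentiableAt_smul hg hσ), add_apply, map_add,
        smul_apply, map_smul, D.ℓ_koszulCov hX hσ,
        D.koszulℓ_smul_right hg hX hσ, ContinuousLinearMap.smulRight_apply, map_smul]
      rfl

/-- The metric hypersurface connection. -/
def connection : Connection E M where
  toFun := D.koszulCov
  isCovariantDerivativeOnUniv := D.isCovariantDerivativeOn_koszulCov

theorem contMDiffAt_koszulγ (hX : CMDiffAt ∞ (T% X) p) (hσ : CMDiffAt ∞ (T% σ) p)
    (hW : CMDiffAt ∞ (T% W) p) : CMDiffAt ∞ (D.koszulγ X σ W) p :=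
  (contMDiffAt_const.mul ((((((contMDiffAt_along hX (D.contMDiffAt_γFun hσ hW)).add
    (contMDiffAt_along hσ (D.contMDiffAt_γFun hX hW))).sub
    (contMDiffAt_along hW (D.contMDiffAt_γFun hX hσ))).add
    (D.contMDiffAt_γFun (contMDiffAt_mlieBracket hX hσ) hW)).sub
    (D.contMDiffAt_γFun (contMDiffAt_mlieBracket hX hW) hσ)).sub
    (D.contMDiffAt_γFun (contMDiffAt_mlieBracket hσ hW) hX))).add
    ((D.contMDiffAt_U hX hσ).mul (D.contMDiffAt_ℓFun hW))

theorem contMDiffAt_koszulℓ (hX : CMDiffAt ∞ (T% X) p) (hσ : CMDiffAt ∞ (T% σ) p) :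
    CMDiffAt ∞ (D.koszulℓ X σ) p :=
  (contMDiffAt_const.mul (((contMDiffAt_along hX (D.contMDiffAt_ℓFun hσ)).add
    (contMDiffAt_along hσ (D.contMDiffAt_ℓFun hX))).add
    (D.contMDiffAt_ℓFun (contMDiffAt_mlieBracket hX hσ)))).add
    (D.contMDiffAt_ℓ₂.mul (D.contMDiffAt_U hX hσ))

/-- A vector field is smooth if its pairings with smooth vector fields are. -/
theorem contMDiffAt_of_γFun_of_ℓFun
    (h : ∀ W : Π p : M, TangentSpace 𝓘(ℝ, E) p, CMDiffAt ∞ (T% W) p → CMDiffAt ∞ (D.γFun X W) p)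
    (h' : CMDiffAt ∞ (D.ℓFun X) p) : CMDiffAt ∞ (T% X) p := by
  let b := Module.finBasis ℝ (TangentSpace 𝓘(ℝ, E) p)
  let Z := fun i => FiberBundle.extend E (b i)
  have hZ : ∀ i, CMDiffAt ∞ (T% (Z i)) p := fun i =>
    FiberBundle.contMDiffAt_extend 𝓘(ℝ, E) E (b i)
  have hcard : Fintype.card (Fin (Module.finrank ℝ (TangentSpace 𝓘(ℝ, E) p)))
      = Module.finrank ℝ E := by rw [Fintype.card_fin]; rfl
  have h0 := D.det_gram_ne_zero (Z := Z) b fun i => by simp [Z]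
  have hev := D.eventually_det_gram_ne_zero hZ h0
  have hH := contMDiffAt_matrix_inv (D.contMDiffAt_gram hZ) h0
  -- These coefficients are those of `(X, 0)` in the frame: the `none` slot carries `ℓ(X)`, the
  -- others `γ(X, Z_j)`.
  have h1 : CMDiffAt ∞ (T% (fun q => ∑ i, (D.ℓFun X q * (D.gram Z q)⁻¹ none (some i) +
      ∑ j, D.γFun X (Z j) q * (D.gram Z q)⁻¹ (some j) (some i)) • Z i q)) p :=
    ContMDiffAt.sum_section fun i _ => ((h'.mul (hH none (some i))).add
      (contMDiffAt_finsetSum fun j _ => (h _ (hZ j)).mul (hH (some j) (some i)))).smul_section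
        (hZ i)
  refine h1.congr_of_eventuallyEq ?_
  filter_upwards [hev] with q hq
  have h2 := congrArg Prod.fst (D.eq_sum_frameVec Z hcard hq (X q, 0))
  congr 1
  simpa [Fintype.sum_option, frameVec, Prod.fst_sum, A_apply, γFun, ℓFun] using h2

theorem contMDiffAt_koszulCov (hX : CMDiffAt ∞ (T% X) p) (hσ : CMDiffAt ∞ (T% σ) p) :
    CMDiffAt ∞ (T% (fun q => D.koszulCov σ q (X q))) p := by
  refine D.contMDiffAt_of_γFun_of_ℓFun (fun W hW => ?_) ?_
  · refine (D.contMDiffAt_koszulγ hX hσ hW).congr_of_eventuallyEq ?_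
    filter_upwards [eventually_mdifferentiableAt hX, eventually_mdifferentiableAt hσ,
      eventually_mdifferentiableAt hW] with q hXq hσq hWq
    exact D.γ_koszulCov hXq hσq hWq
  · refine (D.contMDiffAt_koszulℓ hX hσ).congr_of_eventuallyEq ?_
    filter_upwards [eventually_mdifferentiableAt hX, eventually_mdifferentiableAt hσ] with q hXq hσq
    exact D.ℓ_koszulCov hXq hσq

theorem contMDiffCovariantDerivative_connection :
    D.connection.ContMDiffCovariantDerivative ∞ where
  contMDiff := ⟨fun {σ} hσ => by
    rw [contMDiffOn_univ] at hσ ⊢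
    exact fun p => contMDiffAt_hom_of_apply fun Z hZ =>
      D.contMDiffAt_koszulCov hZ (hσ.contMDiffAt.of_le (by simp))⟩

/-- Each condition combines two Koszul expressions. Exchanging `X` and `Z` and subtracting leaves
only the bracket. Adding the expressions for `γ` with `Z` and `W` exchanged, or those for `ℓ` with
`X` and `Z` exchanged, leaves derivatives and the terms in `U`. -/
theorem isMetricHypersurfaceConnection_connection :
    D.IsMetricHypersurfaceConnection D.connection where
  torsionFree X Z p := by
    have hX := X.mdifferentiableAt (x := p)
    have hZ := Z.mdifferentiableAt (x := p)
    refine D.ext_of_γ_of_ℓ' (fun W hW => ?_) ?_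
    · rw [map_sub, sub_apply]
      change D.γ p (D.koszulCov Z p (X p)) (W p) - D.γ p (D.koszulCov X p (Z p)) (W p) = _
      rw [D.γ_koszulCov hX hZ hW, D.γ_koszulCov hZ hX hW]
      simp only [koszulγ, D.U_comm (X := Z) (Y := X), D.γFun_comm (X := ⇑Z) (Y := ⇑X), γFun]
      rw [lieBracket_swap (X := Z) (Y := X), map_neg, neg_apply]
      ring
    · rw [map_sub]
      change D.ℓ p (D.koszulCov Z p (X p)) - D.ℓ p (D.koszulCov X p (Z p)) = _
      rw [D.ℓ_koszulCov hX hZ, D.ℓ_koszulCov hZ hX]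
      simp only [koszulℓ, D.U_comm (X := Z) (Y := X), ℓFun]
      rw [lieBracket_swap (X := Z) (Y := X), map_neg]
      ring
  nabla_γ X Z W p := by
    have hX := X.mdifferentiableAt (x := p)
    have hZ := Z.mdifferentiableAt (x := p)
    have hW := W.mdifferentiableAt (x := p)
    rw [nablaγ, D.symm p (Z p)]
    change _ - D.γ p (D.koszulCov Z p (X p)) (W p) - D.γ p (D.koszulCov W p (X p)) (Z p) = _
    rw [D.γ_koszulCov hX hZ hW, D.γ_koszulCov hX hW hZ]
    simp only [koszulγ, D.γFun_comm (X := ⇑W) (Y := ⇑Z), γFun]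
    rw [lieBracket_swap (X := W) (Y := Z), map_neg, neg_apply]
    ring
  nabla_ℓ X Z p := by
    have hX := X.mdifferentiableAt (x := p)
    have hZ := Z.mdifferentiableAt (x := p)
    rw [nablaℓ, nablaℓ]
    change _ - D.ℓ p (D.koszulCov Z p (X p)) + (_ - D.ℓ p (D.koszulCov X p (Z p))) = _
    rw [D.ℓ_koszulCov hX hZ, D.ℓ_koszulCov hZ hX]
    simp only [koszulℓ, D.U_comm (X := Z) (Y := X), ℓFun]
    rw [lieBracket_swap (X := Z) (Y := X), map_neg]
    ring

end MetricData

/-! ### The Bianchi identity and the trace of the curvature. -/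

section Trace

variable {E : Type*} [NormedAddCommGroup E] [NormedSpace ℝ E] [FiniteDimensional ℝ E]
  {M : Type*} [TopologicalSpace M] [T2Space M] [ChartedSpace E M] [IsManifold 𝓘(ℝ, E) ∞ M]

theorem VectorFields.contMDiffAt (X : VectorFields E M) {p : M} :
    CMDiffAt ∞ (T% (X : Π p : M, TangentSpace 𝓘(ℝ, E) p)) p := X.contMDiff.contMDiffAt

theorem nabla_apply (cov : Connection E M) [cov.ContMDiffCovariantDerivative ∞]
    (X Z : VectorFields E M) (p : M) : nabla cov X Z p = cov Z p (X p) := rfl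

theorem traceAt_eq_sum {ι : Type*} [Fintype ι] {p : M}
    (b : Module.Basis ι ℝ (TangentSpace 𝓘(ℝ, E) p)) (Φ : VectorFields E M →ₗ[ℝ] VectorFields E M) :
    traceAt p Φ = ∑ i, b.coord i (Φ (extendFrom p (b i)) p) := by
  classical
  rw [traceAt, LinearMap.trace_eq_matrix_trace ℝ b, Matrix.trace]
  simp only [Matrix.diag_apply, LinearMap.toMatrix_apply]
  rfl

theorem traceAt_sub_eq {p : M} {Φ Ψ Θ : VectorFields E M →ₗ[ℝ] VectorFields E M}
    (h : ∀ W, Φ W - Ψ W = Θ W) : traceAt p Φ - traceAt p Ψ = traceAt p Θ := by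
  rw [traceAt, traceAt, traceAt, ← map_sub]
  congr 1
  ext v
  exact congrArg (fun V : VectorFields E M => V p) (h (extendFrom p v))

/-- The first Bianchi identity. -/
theorem curvature_sub_curvature {cov : Connection E M} [cov.ContMDiffCovariantDerivative ∞]
    (htf : ∀ (X Z : VectorFields E M), nabla cov X Z - nabla cov Z X = bracket X Z)
    (X Y W : VectorFields E M) :
    curvature cov W Y X - curvature cov W X Y = curvature cov X Y W := by
  have hsub : ∀ V Z Z' : VectorFields E M,
      nabla cov V (Z - Z') = nabla cov V Z - nabla cov V Z' := fun V Z Z' => by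
    rw [eq_sub_iff_add_eq, ← nabla_add_right, sub_add_cancel]
  have hJ : bracket W (bracket Y X) + bracket Y (bracket X W) + bracket X (bracket W Y) = 0 := by
    ext p
    have h := lieBracket_lieBracket (X := W) (Y := Y) (Z := X) (p := p)
      W.contMDiffAt Y.contMDiffAt X.contMDiffAt
    have h1 : mlieBracket 𝓘(ℝ, E) W X = -mlieBracket 𝓘(ℝ, E) X W := mlieBracket_swap
    have h2 : mlieBracket 𝓘(ℝ, E) Y (mlieBracket 𝓘(ℝ, E) W X) p
        = -mlieBracket 𝓘(ℝ, E) Y (mlieBracket 𝓘(ℝ, E) X W) p := by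
      have := lieBracket_smul_right (X := mlieBracket 𝓘(ℝ, E) X W) (Z := Y)
        (f := fun _ : M => (-1 : ℝ)) (p := p) mdifferentiableAt_const
        ((contMDiffAt_mlieBracket X.contMDiffAt W.contMDiffAt).mdifferentiableAt (by simp))
      rw [along_const, zero_smul, zero_add, neg_one_smul] at this
      rw [← this, h1]
      congr 1
      ext q
      exact (neg_one_smul ℝ _).symm
    rw [h2, lieBracket_swap (X := mlieBracket 𝓘(ℝ, E) W Y)] at h
    change mlieBracket 𝓘(ℝ, E) W (mlieBracket 𝓘(ℝ, E) Y X) p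
      + mlieBracket 𝓘(ℝ, E) Y (mlieBracket 𝓘(ℝ, E) X W) p
      + mlieBracket 𝓘(ℝ, E) X (mlieBracket 𝓘(ℝ, E) W Y) p = 0
    rw [h]
    abel
  have hneg : ∀ V V' : VectorFields E M, bracket V V' = -bracket V' V := fun V V' => by
    rw [← htf, ← htf, neg_sub]
  have hn : ∀ V Z : VectorFields E M, nabla cov (-V) Z = -nabla cov V Z := fun V Z => by
    rw [← neg_one_smul ℝ V, nabla_smul_left, neg_one_smul]
  simp only [curvature]
  rw [hneg W X, hneg X Y, hn, hn]
  -- Torsion-freeness turns all brackets into differences of covariant derivatives, after which the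
  -- claim and the Jacobi identity are the same sum.
  rw [← htf W (bracket Y X), ← htf Y (bracket X W), ← htf X (bracket W Y), ← htf Y X, ← htf X W,
    ← htf W Y] at hJ
  rw [← htf Y X, ← htf X W, ← htf W Y]
  simp only [hsub] at hJ ⊢
  rw [← sub_eq_zero, ← hJ]
  abel

theorem ricci_sub_ricci {cov : Connection E M} [cov.ContMDiffCovariantDerivative ∞]
    (htf : ∀ (X Z : VectorFields E M), nabla cov X Z - nabla cov Z X = bracket X Z)
    (X Y : VectorFields E M) (p : M) :
    ricci cov X Y p - ricci cov Y X p = riemannTrace cov X Y p :=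
  traceAt_sub_eq fun W => curvature_sub_curvature htf X Y W

theorem cov_sum_smul (cov : Connection E M) {ι : Type*} (s : Finset ι) (f : ι → M → ℝ)
    (Z : ι → VectorFields E M) {p : M} (hf : ∀ i, MDiffAt (f i) p) :
    MDiffAt (T% (fun q => ∑ i ∈ s, f i q • Z i q)) p ∧
    ∀ v, cov (fun q => ∑ i ∈ s, f i q • Z i q) p v
      = ∑ i ∈ s, (f i p • cov (Z i) p v + mvfderiv 𝓘(ℝ, E) (f i) p v • Z i p) := by
  classical
  have hm : ∀ i, MDiffAt (T% (f i • ⇑(Z i))) p := fun i =>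
    mdifferentiableAt_smul (hf i) (Z i).mdifferentiableAt
  have hM : ∀ s : Finset ι, MDiffAt (T% (fun q => ∑ i ∈ s, f i q • Z i q)) p := fun s =>
    MDifferentiableAt.sum_section fun i _ => hm i
  refine ⟨hM s, fun v => ?_⟩
  induction s using Finset.induction_on with
  | empty =>
    simp only [Finset.sum_empty]
    exact congrArg (fun L => L v) (cov.isCovariantDerivativeOnUniv.zero (x := p))
  | insert a s ha ih =>
    have h1 : (fun q => ∑ i ∈ insert a s, f i q • Z i q)
        = f a • ⇑(Z a) + fun q => ∑ i ∈ s, f i q • Z i q := by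
      ext q; simp [Finset.sum_insert ha]
    rw [h1, cov.isCovariantDerivativeOnUniv.add (hm a) (hM s),
      cov.isCovariantDerivativeOnUniv.leibniz (Z a).mdifferentiableAt (hf a), Finset.sum_insert ha,
      ← ih]
    simp

/-- The trace of the curvature in terms of the connection coefficients of a local frame. -/
theorem riemannTrace_eq {cov : Connection E M} [cov.ContMDiffCovariantDerivative ∞]
    {ι : Type*} [Fintype ι] {p : M} (b : Module.Basis ι ℝ (TangentSpace 𝓘(ℝ, E) p))
    (Γ : VectorFields E M → ι → ι → M → ℝ)
    (hΓ : ∀ V k i, CMDiffAt ∞ (Γ V k i) p)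
    (hΓ' : ∀ V i, ∀ᶠ q in 𝓝 p,
      nabla cov V (extendFrom p (b i)) q = ∑ k, Γ V k i q • extendFrom p (b k) q)
    (X Y : VectorFields E M) :
    riemannTrace cov X Y p = along X (fun q => ∑ i, Γ Y i i q) p
      - along Y (fun q => ∑ i, Γ X i i q) p - ∑ i, Γ (bracket X Y) i i p := by
  classical
  have h1 : ∀ V k i, b.coord i (nabla cov V (extendFrom p (b k)) p) = Γ V i k p := fun V k i => by
    rw [(hΓ' V k).self_of_nhds]
    simp only [extendFrom_apply_self, map_sum, map_smul, smul_eq_mul, Module.Basis.coord_apply,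
      Module.Basis.repr_self, Finsupp.single_apply, mul_ite, mul_one, mul_zero,
      Finset.sum_ite_eq', Finset.mem_univ, if_true]
  -- The frame expansion is differentiated once more, so it must hold near `p` and not only at `p`.
  have h2 : ∀ V W : VectorFields E M, ∀ i,
      b.coord i (nabla cov V (nabla cov W (extendFrom p (b i))) p)
        = ∑ k, Γ W k i p * Γ V i k p + along V (Γ W i i) p := fun V W i => by
    obtain ⟨hm, hs⟩ := cov_sum_smul cov Finset.univ (fun k => Γ W k i)
      (fun k => extendFrom p (b k)) (p := p) fun k => (hΓ W k i).mdiffAt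
    rw [nabla_apply, cov.isCovariantDerivativeOnUniv.congr_of_eventuallyEq
      (nabla cov W _).mdifferentiableAt hm univ_mem (hΓ' W i), hs]
    simp only [map_sum, map_add, map_smul, smul_eq_mul, ← nabla_apply, h1, Finset.sum_add_distrib]
    congr 1
    simp only [extendFrom_apply_self, Module.Basis.coord_apply,
      Module.Basis.repr_self, Finsupp.single_apply, mul_ite, mul_one, mul_zero,
      Finset.sum_ite_eq', Finset.mem_univ, if_true]
    rfl
  have h3 : ∀ V W : VectorFields E M, along V (fun q => ∑ i, Γ W i i q) p
      = ∑ i, along V (Γ W i i) p := fun V W => along_sum fun i _ => (hΓ W i i).mdiffAt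
  -- The quadratic terms are the traces of two matrix products in opposite order, so they cancel in
  -- the trace of the curvature.
  have h4 : ∑ i, ∑ k, Γ Y k i p * Γ X i k p = ∑ i, ∑ k, Γ X k i p * Γ Y i k p := by
    rw [Finset.sum_comm]
    simp only [mul_comm]
  rw [riemannTrace, traceAt_eq_sum b, h3, h3]
  change ∑ i, b.coord i (nabla cov X (nabla cov Y (extendFrom p (b i))) p
    - nabla cov Y (nabla cov X (extendFrom p (b i))) p
    - nabla cov (bracket X Y) (extendFrom p (b i)) p) = _
  simp only [map_sub, h1, h2, Finset.sum_sub_distrib, Finset.sum_add_distrib, h4]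
  ring

end Trace

/-! ### The logarithmic derivative of a determinant is closed. -/

section LogDet

variable {E : Type*} [NormedAddCommGroup E] [NormedSpace ℝ E] [FiniteDimensional ℝ E]
  {M : Type*} [TopologicalSpace M] [T2Space M] [ChartedSpace E M] [IsManifold 𝓘(ℝ, E) ∞ M]

variable {κ : Type*} [Fintype κ] [DecidableEq κ] (G : M → Matrix κ κ ℝ)

/-- The logarithmic derivative `tr (G⁻¹ X(G))` of the determinant of a matrix of functions. -/
def alongLogDet (X : Π p : M, TangentSpace 𝓘(ℝ, E) p) (q : M) : ℝ :=
  ∑ I, ∑ J, (G q)⁻¹ I J * along X (fun r => G r J I) q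

variable {G}

theorem contMDiffAt_alongLogDet (hG : ∀ I J, CMDiff ∞ (fun q => G q I J)) {p : M}
    (h0 : (G p).det ≠ 0) (X : VectorFields E M) : CMDiffAt ∞ (alongLogDet G X) p :=
  contMDiffAt_finsetSum fun I _ => contMDiffAt_finsetSum fun J _ =>
    (contMDiffAt_matrix_inv (fun I J => (hG I J).contMDiffAt) h0 I J).mul
      (contMDiffAt_along X.contMDiffAt (hG J I).contMDiffAt)

/-- The logarithmic derivative of a determinant is a closed one-form. -/
theorem along_alongLogDet (hG : ∀ I J, CMDiff ∞ (fun q => G q I J)) {p : M}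
    (h0 : (G p).det ≠ 0) (X Y : VectorFields E M) :
    along X (alongLogDet G Y) p - along Y (alongLogDet G X) p
      = alongLogDet G (bracket X Y) p := by
  have hG' : ∀ I J, CMDiffAt ∞ (fun q => G q I J) p := fun I J => (hG I J).contMDiffAt
  have hH := contMDiffAt_matrix_inv hG' h0
  have hXG : ∀ (X : VectorFields E M) I J, CMDiffAt ∞ (along X (fun q => G q I J)) p :=
    fun X I J => contMDiffAt_along X.contMDiffAt (hG' I J)
  let dG := fun X : VectorFields E M => Matrix.of fun I J => along X (fun q => G q I J) p
  let dH := fun X : VectorFields E M => Matrix.of fun I J => along X (fun q => (G q)⁻¹ I J) p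
  have hev : ∀ᶠ q in 𝓝 p, (G q).det ≠ 0 :=
    (contMDiffAt_matrix_det hG').continuousAt.eventually_ne h0
  -- Derivative of `G⁻¹ G = 1`, valid near `p` where `det G ≠ 0`.
  have hdH : ∀ X, dH X * G p + (G p)⁻¹ * dG X = 0 := fun X => by
    ext I K
    have h1 : (fun q => ∑ J, ((fun q => (G q)⁻¹ I J) * fun q => G q J K) q)
        =ᶠ[𝓝 p] fun _ => (1 : Matrix κ κ ℝ) I K := by
      filter_upwards [hev] with q hq
      rw [← Matrix.nonsing_inv_mul _ (isUnit_iff_ne_zero.2 hq), Matrix.mul_apply]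
      rfl
    have h2 := along_congr (X := X) h1
    rw [along_const, along_sum fun J _ => (hH I J).mdiffAt.mul (hG' J K).mdiffAt] at h2
    rw [Matrix.add_apply, Matrix.mul_apply, Matrix.mul_apply, ← Finset.sum_add_distrib,
      Matrix.zero_apply, ← h2]
    refine Finset.sum_congr rfl fun J _ => ?_
    rw [along_mul (hH I J).mdiffAt (hG' J K).mdiffAt]
    simp only [dH, dG, Matrix.of_apply]
    ring
  have hdH' : ∀ X, dH X = -((G p)⁻¹ * dG X * (G p)⁻¹) := fun X => by
    have h1 := congrArg (· * (G p)⁻¹) (eq_neg_of_add_eq_zero_left (hdH X))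
    simp only [Matrix.mul_assoc, Matrix.mul_nonsing_inv _ (isUnit_iff_ne_zero.2 h0),
      Matrix.mul_one, neg_mul] at h1
    rw [h1, Matrix.mul_assoc]
  -- Both sides equal `-tr(G⁻¹ X(G) G⁻¹ Y(G))` up to cyclic order, so first-derivative products drop
  -- out on antisymmetrising; the second derivatives of `G` give the bracket.
  have hsymm : (dH X * dG Y).trace = (dH Y * dG X).trace := by
    rw [hdH', hdH', neg_mul, neg_mul, Matrix.trace_neg, Matrix.trace_neg,
      Matrix.mul_assoc _ _ (dG Y), Matrix.trace_mul_comm, Matrix.mul_assoc ((G p)⁻¹) (dG Y)]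
    simp only [Matrix.mul_assoc]
  have hexp : ∀ X Y : VectorFields E M, along X (alongLogDet G Y) p
      = (dH X * dG Y).trace
        + ∑ I, ∑ J, (G p)⁻¹ I J * along X (along Y (fun r => G r J I)) p := fun X Y => by
    have h1 : ∀ I J, MDiffAt ((fun q => (G q)⁻¹ I J) * along Y (fun r => G r J I)) p :=
      fun I J => (hH I J).mdiffAt.mul (hXG Y J I).mdiffAt
    have h2 : alongLogDet G Y = fun q => ∑ I, (fun q => ∑ J,
        ((fun q => (G q)⁻¹ I J) * along Y (fun r => G r J I)) q) q := rfl
    rw [h2, along_sum fun I _ => mdifferentiableAt_sum fun J _ => h1 I J, Matrix.trace,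
      ← Finset.sum_add_distrib]
    refine Finset.sum_congr rfl fun I _ => ?_
    rw [along_sum fun J _ => h1 I J, Matrix.diag_apply, Matrix.mul_apply,
      ← Finset.sum_add_distrib]
    refine Finset.sum_congr rfl fun J _ => ?_
    rw [along_mul (hH I J).mdiffAt (hXG Y J I).mdiffAt]
    simp only [dH, dG, Matrix.of_apply]
    ring
  have hbr : ∀ I J, along (bracket X Y) (fun r => G r J I) p
      = along X (along Y (fun r => G r J I)) p - along Y (along X (fun r => G r J I)) p :=
    fun I J => along_lieBracket X Y (hG J I) p
  rw [hexp, hexp, hsymm, alongLogDet]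
  simp only [hbr, mul_sub, Finset.sum_sub_distrib]
  ring

end LogDet

/-! ### The traced connection coefficients and their exterior derivative. -/

namespace MetricData

variable {E : Type*} [NormedAddCommGroup E] [NormedSpace ℝ E] [FiniteDimensional ℝ E]
  {M : Type*} [TopologicalSpace M] [T2Space M] [ChartedSpace E M] [IsManifold 𝓘(ℝ, E) ∞ M]
  {D : MetricData E M} {cov : Connection E M} [cov.ContMDiffCovariantDerivative ∞]

/-- The symmetric part of `∇ℓ` is prescribed, and torsion-freeness makes its antisymmetric part
equal to `½ dℓ = F`. -/
theorem IsMetricHypersurfaceConnection.nablaℓ_eq (h : D.IsMetricHypersurfaceConnection cov)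
    (X Z : VectorFields E M) (p : M) :
    D.nablaℓ cov X Z p = D.F X Z p - D.ℓ₂ p * D.U X Z p := by
  have h1 := h.nabla_ℓ X Z p
  have h2 := congrArg (D.ℓ p) (h.torsionFree X Z p)
  rw [map_sub] at h2
  simp only [nablaℓ] at h1 ⊢
  simp only [F, dOneForm]
  rw [show D.ℓFun (mlieBracket 𝓘(ℝ, E) X Z) p = _ from h2.symm]
  linarith

section Coefficients

variable (D cov) {ι : Type*} [Fintype ι] [DecidableEq ι] (Z : ι → VectorFields E M)

/-- The coefficients of `∇_V Z_i` in the frame `Z_k`, computed with the Gram matrix of `A`. -/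
def connectionCoeff (V : VectorFields E M) (k i : ι) (q : M) : ℝ :=
  D.ℓFun (nabla cov V (Z i)) q * (D.gram (fun i => Z i) q)⁻¹ none (some k)
    + ∑ j, D.γFun (nabla cov V (Z i)) (Z j) q * (D.gram (fun i => Z i) q)⁻¹ (some j) (some k)

theorem contMDiffAt_connectionCoeff {p : M} (h0 : (D.gram (fun i => Z i) p).det ≠ 0)
    (V : VectorFields E M) (k i : ι) : CMDiffAt ∞ (D.connectionCoeff cov Z V k i) p := by
  have hH := contMDiffAt_matrix_inv (D.contMDiffAt_gram fun i => (Z i).contMDiffAt) h0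
  exact ((D.contMDiffAt_ℓFun (nabla cov V (Z i)).contMDiffAt).mul (hH _ _)).add
    (contMDiffAt_finsetSum fun j _ =>
      (D.contMDiffAt_γFun (nabla cov V (Z i)).contMDiffAt (Z j).contMDiffAt).mul (hH _ _))

theorem nabla_eq_sum_connectionCoeff (hcard : Fintype.card ι = Module.finrank ℝ E) {q : M}
    (h0 : (D.gram (fun i => Z i) q).det ≠ 0) (V : VectorFields E M) (i : ι) :
    nabla cov V (Z i) q = ∑ k, D.connectionCoeff cov Z V k i q • Z k q := by
  have h2 := congrArg Prod.fst (D.eq_sum_frameVec (fun i => Z i) hcard h0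
    (nabla cov V (Z i) q, 0))
  simpa [Fintype.sum_option, frameVec, Prod.fst_sum, A_apply, connectionCoeff, γFun, ℓFun] using h2

variable {D cov}

/-- The trace of the connection coefficients of a metric hypersurface connection. -/
theorem IsMetricHypersurfaceConnection.sum_connectionCoeff
    (h : D.IsMetricHypersurfaceConnection cov)
    (hcard : Fintype.card ι = Module.finrank ℝ E) {q : M}
    (h0 : (D.gram (fun i => Z i) q).det ≠ 0) (V : VectorFields E M) :
    ∑ i, D.connectionCoeff cov Z V i i q
      = 1 / 2 * (alongLogDet (D.gram fun i => Z i) V q - D.n₂ q * along V D.ℓ₂ q) + D.s V q := by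
  set H := (D.gram (fun i => Z i) q)⁻¹ with hH
  have hsymm : ∀ I J, H I J = H J I := D.inv_gram_symm _ q
  have hn₂ : D.n₂ q = H none none := D.n₂_eq _ hcard h0
  let u := fun i => D.U V (Z i) q
  let l := fun i => D.ℓFun (Z i) q
  let g := fun i j => D.γFun (nabla cov V (Z i)) (Z j) q
  let m := fun i => D.ℓFun (nabla cov V (Z i)) q
  -- The `H none (some i)` are the components of `n`, so this is `F(V,n) = -ŝ(V)`.
  have hs : ∑ i, H none (some i) * D.F V (Z i) q = -D.s V q := by
    let φ := TensorialAt.mkHom (fun X => D.F X V q) q (D.tensorialAt_F V q)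
    have h1 : φ (D.n q) = D.s V q :=
      TensorialAt.mkHom_apply (D.tensorialAt_F V q) D.mdifferentiableAt_n
    have h2 : ∀ i, φ (Z i q) = -D.F V (Z i) q := fun i => by
      rw [TensorialAt.mkHom_apply (D.tensorialAt_F V q) (Z i).mdifferentiableAt, D.F_swap]
    rw [← h1, D.n_eq_sum _ hcard h0, map_sum, ← Finset.sum_neg_distrib]
    refine Finset.sum_congr rfl fun i _ => ?_
    rw [map_smul, h2, smul_eq_mul, mul_neg, neg_neg]
  -- Entry `(some i, none)` of `G⁻¹ G = 1`.
  have hHl : ∀ i, ∑ j, H (some i) (some j) * l j = -(H (some i) none * D.ℓ₂ q) := fun i => by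
    have h1 := congrFun (congrFun (Matrix.nonsing_inv_mul _ (isUnit_iff_ne_zero.2 h0)) (some i))
      none
    rw [Matrix.mul_apply, Fintype.sum_option, Matrix.one_apply_ne (by simp)] at h1
    simp only [gram_none_none, gram_some_none, ← hH] at h1
    linarith
  have hγ : ∀ i j, along V (D.γFun (Z i) (Z j)) q = g i j + g j i - u i * l j - u j * l i :=
    fun i j => by
      have h1 := h.nabla_γ V (Z i) (Z j) q
      have h2 : D.γ q (Z i q) (cov (Z j) q (V q)) = g j i := D.symm q _ _
      rw [nablaγ, h2] at h1
      change _ - g i j - g j i = -u i * l j - u j * l i at h1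
      linarith
  have hℓ : ∀ i, along V (D.ℓFun (Z i)) q = m i + D.F V (Z i) q - D.ℓ₂ q * u i := fun i => by
    have h1 := h.nablaℓ_eq V (Z i) q
    rw [nablaℓ] at h1
    change _ - m i = _ - D.ℓ₂ q * u i at h1
    linarith
  have hτ : ∑ i, D.connectionCoeff cov Z V i i q
      = ∑ i, m i * H none (some i) + ∑ i, ∑ j, g i j * H (some j) (some i) := by
    rw [← Finset.sum_add_distrib]
    rfl
  -- The trace split into blocks; the factor `2` counts the two equal off-diagonal blocks.
  have hκ : alongLogDet (D.gram fun i => Z i) V q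
      = H none none * along V D.ℓ₂ q + 2 * ∑ i, H none (some i) * along V (D.ℓFun (Z i)) q
        + ∑ i, ∑ j, H (some i) (some j) * along V (D.γFun (Z j) (Z i)) q := by
    simp only [alongLogDet, Fintype.sum_option, gram_none_none, gram_some_none, gram_none_some,
      gram_some_some, Finset.sum_add_distrib, ← hH]
    have : ∑ i, H (some i) none * along V (fun r => D.ℓFun (Z i) r) q
        = ∑ i, H none (some i) * along V (fun r => D.ℓFun (Z i) r) q :=
      Finset.sum_congr rfl fun i _ => by rw [hsymm]
    rw [this]
    ring
  have hg1 : ∑ i, ∑ j, H (some i) (some j) * g j i = ∑ i, ∑ j, g i j * H (some j) (some i) := by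
    rw [Finset.sum_comm]
    exact Finset.sum_congr rfl fun i _ => Finset.sum_congr rfl fun j _ => mul_comm _ _
  have hg2 : ∑ i, ∑ j, H (some i) (some j) * g i j = ∑ i, ∑ j, g i j * H (some j) (some i) :=
    Finset.sum_congr rfl fun i _ => Finset.sum_congr rfl fun j _ => by rw [mul_comm, hsymm]
  have hu1 : ∑ i, ∑ j, H (some i) (some j) * (u i * l j)
      = -(D.ℓ₂ q * ∑ i, H none (some i) * u i) := by
    rw [Finset.mul_sum, ← Finset.sum_neg_distrib]
    refine Finset.sum_congr rfl fun i _ => ?_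
    have : ∑ j, H (some i) (some j) * (u i * l j) = u i * ∑ j, H (some i) (some j) * l j := by
      rw [Finset.mul_sum]
      exact Finset.sum_congr rfl fun j _ => by ring
    rw [this, hHl, hsymm]
    ring
  have hu2 : ∑ i, ∑ j, H (some i) (some j) * (u j * l i)
      = -(D.ℓ₂ q * ∑ i, H none (some i) * u i) := by
    rw [← hu1, Finset.sum_comm]
    exact Finset.sum_congr rfl fun i _ => Finset.sum_congr rfl fun j _ => by rw [hsymm]
  have hγ' : ∑ i, ∑ j, H (some i) (some j) * along V (D.γFun (Z j) (Z i)) q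
      = 2 * ∑ i, ∑ j, g i j * H (some j) (some i)
        + 2 * (D.ℓ₂ q * ∑ i, H none (some i) * u i) := by
    simp only [hγ, mul_sub, mul_add, Finset.sum_sub_distrib, Finset.sum_add_distrib, hg1, hg2,
      hu1, hu2]
    ring
  have hℓ' : ∑ i, H none (some i) * along V (D.ℓFun (Z i)) q
      = ∑ i, m i * H none (some i) - D.s V q - D.ℓ₂ q * ∑ i, H none (some i) * u i := by
    simp only [hℓ, mul_sub, mul_add, Finset.sum_sub_distrib, Finset.sum_add_distrib, hs]
    rw [Finset.mul_sum, Finset.sum_congr rfl fun i _ => mul_comm (m i) _,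
      Finset.sum_congr rfl fun i _ => mul_left_comm (D.ℓ₂ q) _ _]
    ring
  -- The terms `ℓ⁽²⁾ U(V,n)` enter through `hγ'` with coefficient `2` and through twice `hℓ'` with
  -- coefficient `-2`, so `U` disappears.
  rw [hτ, hκ, hγ', hℓ', hn₂]
  ring

end Coefficients

theorem contMDiffAt_s (V : VectorFields E M) (p : M) : CMDiffAt ∞ (D.s V) p :=
  D.contMDiffAt_F D.contMDiffAt_n V.contMDiffAt

theorem IsMetricHypersurfaceConnection.riemannTrace_eq
    (h : D.IsMetricHypersurfaceConnection cov) (X Y : VectorFields E M) (p : M) :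
    riemannTrace cov X Y p = dOneForm D.s X Y p - 1 / 2 * wedgeDiff D.n₂ D.ℓ₂ X Y p := by
  let b := Module.finBasis ℝ (TangentSpace 𝓘(ℝ, E) p)
  -- The fields are global, though a frame only near `p`, so the Gram entries are globally smooth,
  -- as the commutator formula requires.
  let Z := fun i => extendFrom p (b i)
  have hcard : Fintype.card (Fin (Module.finrank ℝ (TangentSpace 𝓘(ℝ, E) p)))
      = Module.finrank ℝ E := by rw [Fintype.card_fin]; rfl
  have h0 : (D.gram (fun i => Z i) p).det ≠ 0 :=
    D.det_gram_ne_zero b fun i => extendFrom_apply_self p (b i)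
  have hev := D.eventually_det_gram_ne_zero (fun i => (Z i).contMDiffAt) h0
  rw [HypersurfaceData.riemannTrace_eq b (D.connectionCoeff cov Z)
    (D.contMDiffAt_connectionCoeff cov Z h0)
    (fun V i => hev.mono fun q hq => D.nabla_eq_sum_connectionCoeff cov Z hcard hq V i)]
  have hG : ∀ I J, CMDiff ∞ (fun q => D.gram (fun i => Z i) q I J) := fun I J p =>
    D.contMDiffAt_gram (fun i => (Z i).contMDiffAt) I J
  have hn₂ : MDiffAt D.n₂ p := D.contMDiffAt_n₂.mdiffAt
  have hτ : ∀ V W : VectorFields E M,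
      along V (fun q => ∑ i, D.connectionCoeff cov Z W i i q) p
        = 1 / 2 * (along V (alongLogDet (D.gram fun i => Z i) W) p
          - (D.n₂ p * along V (along W D.ℓ₂) p + along W D.ℓ₂ p * along V D.n₂ p))
          + along V (D.s W) p := fun V W => by
    have h1 : (fun q => ∑ i, D.connectionCoeff cov Z W i i q) =ᶠ[𝓝 p]
        (fun q => 1 / 2 * (alongLogDet (D.gram fun i => Z i) W - D.n₂ * along W D.ℓ₂) q)
          + D.s W := by
      filter_upwards [hev] with q hq
      exact h.sum_connectionCoeff Z hcard hq W
    have h2 := (contMDiffAt_alongLogDet hG h0 W).mdiffAt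
    have h3 := (contMDiffAt_along W.contMDiffAt (D.contMDiffAt_ℓ₂ (p := p))).mdiffAt
    have h4 := h2.sub (hn₂.mul h3)
    have h5 : MDiffAt (fun q => 1 / 2 * (alongLogDet (D.gram fun i => Z i) W
        - D.n₂ * along W D.ℓ₂) q) p := mdifferentiableAt_const.mul h4
    rw [along_congr h1, along_add h5 (D.contMDiffAt_s W p).mdiffAt,
      along_const_mul _ h4, along_sub h2 (hn₂.mul h3), along_mul hn₂ h3]
  -- Closedness removes the logarithmic derivative, and the second derivatives of `ℓ⁽²⁾` cancel
  -- against `[X,Y](ℓ⁽²⁾)`, so only products of first derivatives and `dŝ` remain.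
  rw [hτ, hτ, h.sum_connectionCoeff Z hcard h0, dOneForm, wedgeDiff,
    ← along_alongLogDet hG h0,
    show along (bracket X Y) D.ℓ₂ p = _ from along_lieBracket X Y D.smooth_ℓ₂ p]
  change _ = _ - D.s (bracket X Y) p - _
  ring

end MetricData

end HypersurfaceData

end

theorem mainTheorem10
    {E : Type*} [NormedAddCommGroup E] [NormedSpace ℝ E] [FiniteDimensional ℝ E]
    {M : Type*} [TopologicalSpace M] [T2Space M] [ChartedSpace E M] [IsManifold 𝓘(ℝ, E) ∞ M]
    (D : HypersurfaceData.MetricData E M) :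
    (∃ cov : HypersurfaceData.Connection E M,
      cov.ContMDiffCovariantDerivative ∞ ∧ D.IsMetricHypersurfaceConnection cov) ∧
    ∀ (cov : HypersurfaceData.Connection E M) [cov.ContMDiffCovariantDerivative ∞],
      D.IsMetricHypersurfaceConnection cov →
      ∀ (X Y : HypersurfaceData.VectorFields E M) (p : M),
        HypersurfaceData.ricci cov X Y p - HypersurfaceData.ricci cov Y X p
            = HypersurfaceData.riemannTrace cov X Y p ∧
        HypersurfaceData.riemannTrace cov X Y p
            = HypersurfaceData.dOneForm D.s X Y p
              - 1 / 2 * HypersurfaceData.wedgeDiff D.n₂ D.ℓ₂ X Y p := by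
  refine ⟨⟨D.connection, D.contMDiffCovariantDerivative_connection,
    D.isMetricHypersurfaceConnection_connection⟩, fun cov _ h X Y p => ⟨?_, ?_⟩⟩
  · exact HypersurfaceData.ricci_sub_ricci
      (fun X Z => ContMDiffSection.ext fun q => h.torsionFree X Z q) X Y p
  · exact h.riemannTrace_eq X Y p
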